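/- Let $G=\mathrm{SL}_3(\mathbb R)$, $K=\mathrm{SO}(3)$, and let $X=G/K$ be the Riemannian symmetric space with the distance $d$ of the Riemannian metric induced by the Killing form $B(x,y)=6\operatorname{Tr}(xy)$; put $o=[K]\in X$. (Equivalently, $X$ is the space of positive definite symmetric real $3\times 3$ matrices of determinant one, $G$ acts by $g\cdot P=gPg^{T}$, and $o$ is the identity matrix.) Let $H$ be the identity component of $$\mathrm{SO}(F)=\{g\in G: F(gv)=F(v)\ \text{for all } v\in\mathbb R^3\},\qquad F(x,y,z)=2xz-y^2,$$ and let $Y=H\cdot o\subset X$, a totally geodesic plane. Every $x\in X$ has a unique nearest point $\pi(x)$ in $Y$, that is, a unique point $\pi(x)\in Y$ with $d(x,\pi(x))=\inf_{y\in Y}d(x,y)$; let $\pi:X\to Y$ be this nearest-point projection. Let $A<G$ be the group of diagonal matrices with positive entries, let $A_0=H\cap A$, and for $t\in\mathbb R$ let $a_t=\mathrm{diag}(e^{t},e^{-2t},e^{t})$. Every complete geodesic $L\subset Y$ is of the form $L=hA_0o$ with $h\in H$, and the floating geodesic plane over $L$ at height $t\in\mathbb R$ is $Y_{L,t}=h\,a_tY$,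 which does not depend on the choice of such an $h$. Theorem. For every complete geodesic $L\subset Y$, the Hausdorff distance between $\pi(Y_{L,t})$ and $L$ tends to $0$ as $|t|\to\infty$. -/

import Mathlib

open Matrix Filter Topology
open scoped Pointwise ENNReal

noncomputable section

namespace FloatingPlane

/-- The group `G = SL₃(ℝ)`. -/
abbrev G : Type := Matrix.SpecialLinearGroup (Fin 3) ℝ

/-- The symmetric space `X = SL₃(ℝ) / SO(3)`, realised as the space of positive definite symmetric
real `3 × 3` matrices of determinant one; the coset `g SO(3)` corresponds to `g gᵀ`. -/
@[ext]
structure X : Type where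
  mat : Matrix (Fin 3) (Fin 3) ℝ
  posDef : mat.PosDef
  det_eq_one : mat.det = 1

/-- The action of `G` on `X` by left translation of cosets, that is, `g • P = g P gᵀ`. -/
instance : MulAction G X where
  smul g P :=
    { mat := g.1 * P.mat * g.1ᵀ
      posDef := by
        have h := P.posDef.mul_mul_conjTranspose_same (B := g.1)
          (Matrix.vecMul_injective_of_isUnit
            ((Matrix.isUnit_iff_isUnit_det _).2 (by rw [g.2]; exact isUnit_one)))
        simpa [Matrix.conjTranspose_eq_transpose_of_trivial] using h
      det_eq_one := by
        rw [Matrix.det_mul, Matrix.det_mul, Matrix.det_transpose, g.2, P.det_eq_one]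
        norm_num }
  one_smul P := by
    apply X.ext
    change (1 : G).1 * P.mat * (1 : G).1ᵀ = P.mat
    simp
  mul_smul g h P := by
    apply X.ext
    change (g * h).1 * P.mat * (g * h).1ᵀ = g.1 * (h.1 * P.mat * h.1ᵀ) * g.1ᵀ
    simp [Matrix.mul_assoc]

/-- The base point `o = [SO(3)]`. -/
def o : X where
  mat := 1
  posDef := Matrix.PosDef.one
  det_eq_one := Matrix.det_one

/-! ### The Riemannian metric induced by the Killing form -/

/-- The Riemannian norm of a tangent vector `V` (a symmetric matrix with `tr (P⁻¹ V) = 0`) at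
`P`. If `P = g gᵀ`, then `V` is the velocity at `s = 0` of `s ↦ g exp (s x) • o` for the traceless
symmetric matrix `x = (1/2) g⁻¹ V g⁻ᵀ`, and the norm of `V` is `√(B (x, x))` with the Killing form
`B (x, x) = 6 tr (x²)`; moreover `x` is conjugate to `(1/2) P⁻¹ V`. -/
def tangentNorm (P V : Matrix (Fin 3) (Fin 3) ℝ) : ℝ :=
  Real.sqrt (6 * (((1 / 2 : ℝ) • (P⁻¹ * V)) ^ 2).trace)

/-- A `C¹` curve in `X` that is at `p` at time `0` and at `q` at time `1`. (Only its restriction to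
`[0, 1]` matters.) -/
structure C1Curve (p q : X) : Type where
  toFun : ℝ → X
  contDiff : ∀ i j, ContDiff ℝ 1 fun t => (toFun t).mat i j
  source : toFun 0 = p
  target : toFun 1 = q

namespace C1Curve

variable {p q r : X}

/-- The velocity of a curve. -/
def velocity (γ : C1Curve p q) (t : ℝ) : Matrix (Fin 3) (Fin 3) ℝ :=
  Matrix.of fun i j => deriv (fun s => (γ.toFun s).mat i j) t

/-- The Riemannian speed of a curve. -/
def speed (γ : C1Curve p q) (t : ℝ) : ℝ :=
  tangentNorm (γ.toFun t).mat (γ.velocity t)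

/-- The Riemannian length of a curve on `[0, 1]`. -/
def length (γ : C1Curve p q) : ℝ := ∫ t in (0 : ℝ)..1, γ.speed t

end C1Curve

/-- The Riemannian distance: the infimum of the lengths of the `C¹` curves joining two points. -/
def riemEDist (p q : X) : ℝ≥0∞ := ⨅ γ : C1Curve p q, ENNReal.ofReal γ.length

/-! ### The Riemannian distance is a distance -/

namespace C1Curve

variable {p q r : X}

theorem tangentNorm_nonneg (P V : Matrix (Fin 3) (Fin 3) ℝ) : 0 ≤ tangentNorm P V :=
  Real.sqrt_nonneg _

theorem tangentNorm_smul (c : ℝ) (P V : Matrix (Fin 3) (Fin 3) ℝ) :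
    tangentNorm P (c • V) = |c| * tangentNorm P V := by
  unfold tangentNorm
  rw [← Real.sqrt_sq_eq_abs, ← Real.sqrt_mul (sq_nonneg c)]
  congr 1
  simp only [pow_two, Matrix.mul_smul, Matrix.smul_mul, Matrix.trace_smul, smul_eq_mul]
  ring

theorem tangentNorm_zero (P : Matrix (Fin 3) (Fin 3) ℝ) : tangentNorm P 0 = 0 := by
  simp [tangentNorm]

theorem continuous_mat (γ : C1Curve p q) : Continuous fun t => (γ.toFun t).mat :=
  continuous_matrix fun i j => (γ.contDiff i j).continuous

theorem continuous_velocity (γ : C1Curve p q) : Continuous γ.velocity :=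
  continuous_matrix fun i j => (γ.contDiff i j).continuous_deriv le_rfl

theorem continuous_speed (γ : C1Curve p q) : Continuous γ.speed := by
  have h : ∀ t, (γ.toFun t).mat⁻¹ = (γ.toFun t).mat.adjugate := fun t => by
    rw [Matrix.inv_def, (γ.toFun t).det_eq_one]; simp
  unfold speed tangentNorm
  simp only [h]
  have h1 := γ.continuous_mat.matrix_adjugate
  have h2 := ((h1.matrix_mul γ.continuous_velocity).const_smul (1 / 2 : ℝ)).pow 2
  exact (continuous_const.mul h2.matrix_trace).sqrt

theorem hasDerivAt (γ : C1Curve p q) (t : ℝ) (i j : Fin 3) :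
    HasDerivAt (fun s => (γ.toFun s).mat i j) (γ.velocity t i j) t :=
  ((γ.contDiff i j).differentiable one_ne_zero t).hasDerivAt

/-- The constant curve. -/
def const (p : X) : C1Curve p p where
  toFun _ := p
  contDiff _ _ := contDiff_const
  source := rfl
  target := rfl

theorem length_const (p : X) : (const p).length = 0 := by
  have h : ∀ t, (const p).velocity t = 0 := fun t => by
    ext i j
    simp [velocity, const]
  simp [length, speed, h, tangentNorm_zero]

/-- The reversed curve. -/
def symm (γ : C1Curve p q) : C1Curve q p where
  toFun t := γ.toFun (1 - t)
  contDiff i j := (γ.contDiff i j).comp (contDiff_const.sub contDiff_id)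
  source := by simpa using γ.target
  target := by simpa using γ.source

theorem length_symm (γ : C1Curve p q) : γ.symm.length = γ.length := by
  have h : ∀ t, γ.symm.speed t = γ.speed (1 - t) := fun t => by
    have hv : γ.symm.velocity t = (-1 : ℝ) • γ.velocity (1 - t) := by
      ext i j
      have h1 : HasDerivAt (fun s : ℝ => 1 - s) (-1) t := by
        simpa using (hasDerivAt_id t).const_sub 1
      have h2 := (γ.hasDerivAt (1 - t) i j).comp t h1
      have h3 := h2.deriv
      simp only [Matrix.smul_apply, smul_eq_mul]
      rw [mul_comm, ← h3]
      rfl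
    rw [speed, hv, tangentNorm_smul]
    simp [speed, symm]
  simp only [length, h]
  simp [intervalIntegral.integral_comp_sub_left]

theorem smooth_deriv_eq_zero {c d t : ℝ} (h : c * t + d < 0 ∨ 1 < c * t + d) :
    deriv (fun s => Real.smoothTransition (c * s + d)) t = 0 := by
  have hc : Continuous fun s : ℝ => c * s + d := by fun_prop
  rcases h with h | h
  · have : (fun s => Real.smoothTransition (c * s + d)) =ᶠ[𝓝 t] fun _ => (0 : ℝ) := by
      filter_upwards [hc.continuousAt.eventually (gt_mem_nhds h)] with s hs
      exact Real.smoothTransition.zero_of_nonpos hs.le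
    rw [this.deriv_eq]; simp
  · have : (fun s => Real.smoothTransition (c * s + d)) =ᶠ[𝓝 t] fun _ => (1 : ℝ) := by
      filter_upwards [hc.continuousAt.eventually (lt_mem_nhds h)] with s hs
      exact Real.smoothTransition.one_of_one_le hs.le
    rw [this.deriv_eq]; simp

theorem smooth_contDiff (c d : ℝ) :
    ContDiff ℝ 1 fun s => Real.smoothTransition (c * s + d) := by
  have := Real.smoothTransition.contDiff (n := 1)
  exact this.comp (by fun_prop)

theorem smooth_deriv_nonneg (d t : ℝ) :
    0 ≤ deriv (fun s => Real.smoothTransition (4 * s + d)) t := by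
  apply Monotone.deriv_nonneg
  intro a b hab
  exact Real.smoothTransition.monotone (by linarith)

/-- Concatenation of curves; both are slowed down to be constant near the junction. -/
def trans (γ : C1Curve p q) (δ : C1Curve q r) : C1Curve p r where
  toFun t := if t ≤ 1 / 2 then γ.toFun (Real.smoothTransition (4 * t + 0))
    else δ.toFun (Real.smoothTransition (4 * t + (-3)))
  contDiff i j := by
    have h : ContDiff ℝ 1 fun t => (γ.toFun (Real.smoothTransition (4 * t + 0))).mat i j
        + (δ.toFun (Real.smoothTransition (4 * t + (-3)))).mat i j - q.mat i j :=
      (((γ.contDiff i j).comp (smooth_contDiff 4 0)).add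
        ((δ.contDiff i j).comp (smooth_contDiff 4 (-3)))).sub contDiff_const
    convert h using 2 with t
    split_ifs with ht
    · rw [Real.smoothTransition.zero_of_nonpos (x := 4 * t + (-3)) (by linarith), δ.source]
      ring
    · rw [Real.smoothTransition.one_of_one_le (x := 4 * t + 0) (by linarith), γ.target]
      ring
  source := by simp [γ.source]
  target := by
    rw [if_neg (by norm_num), Real.smoothTransition.one_of_one_le (by norm_num), δ.target]

theorem length_trans (γ : C1Curve p q) (δ : C1Curve q r) :
    (γ.trans δ).length = γ.length + δ.length := by
  set φ : ℝ → ℝ := fun s => Real.smoothTransition (4 * s + 0) with hφ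
  set ψ : ℝ → ℝ := fun s => Real.smoothTransition (4 * s + (-3)) with hψ
  have hφd : ∀ t, HasDerivAt φ (deriv φ t) t := fun t =>
    ((smooth_contDiff 4 0).differentiable one_ne_zero t).hasDerivAt
  have hψd : ∀ t, HasDerivAt ψ (deriv ψ t) t := fun t =>
    ((smooth_contDiff 4 (-3)).differentiable one_ne_zero t).hasDerivAt
  have hφc : Continuous (deriv φ) := (smooth_contDiff 4 0).continuous_deriv le_rfl
  have hψc : Continuous (deriv ψ) := (smooth_contDiff 4 (-3)).continuous_deriv le_rfl
  have hvel : ∀ t, (γ.trans δ).velocity t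
      = deriv φ t • γ.velocity (φ t) + deriv ψ t • δ.velocity (ψ t) := fun t => by
    ext i j
    have h1 := (γ.hasDerivAt (φ t) i j).comp t (hφd t)
    have h2 := (δ.hasDerivAt (ψ t) i j).comp t (hψd t)
    have h3 := ((h1.add h2).sub_const (q.mat i j)).deriv
    have h4 : (fun s => ((γ.trans δ).toFun s).mat i j) = fun s =>
        (γ.toFun (φ s)).mat i j + (δ.toFun (ψ s)).mat i j - q.mat i j := by
      funext s
      simp only [trans]
      split_ifs with hs
      · rw [show ψ s = 0 from Real.smoothTransition.zero_of_nonpos (by linarith), δ.source]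
        simp [hφ]
      · rw [show φ s = 1 from Real.smoothTransition.one_of_one_le (by linarith), γ.target]
        simp [hψ]
    simp only [velocity, Matrix.of_apply, Matrix.add_apply, Matrix.smul_apply, smul_eq_mul] at h3 ⊢
    rw [h4, mul_comm (deriv φ t), mul_comm (deriv ψ t), ← h3]
    rfl
  have hspeed : ∀ t, (γ.trans δ).speed t
      = γ.speed (φ t) * deriv φ t + δ.speed (ψ t) * deriv ψ t := fun t => by
    unfold speed
    rw [hvel]
    by_cases ht : t ≤ 1 / 2
    · have h0 : deriv ψ t = 0 := smooth_deriv_eq_zero (Or.inl (by linarith))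
      have h1 : (γ.trans δ).toFun t = γ.toFun (φ t) := by simp only [trans, if_pos ht, hφ]
      rw [h0, h1, zero_smul, add_zero, tangentNorm_smul,
        abs_of_nonneg (smooth_deriv_nonneg 0 t)]
      ring
    · have h0 : deriv φ t = 0 := smooth_deriv_eq_zero (Or.inr (by linarith))
      have h1 : (γ.trans δ).toFun t = δ.toFun (ψ t) := by simp only [trans, if_neg ht, hψ]
      rw [h0, h1, zero_smul, zero_add, tangentNorm_smul,
        abs_of_nonneg (smooth_deriv_nonneg (-3) t)]
      ring
  have hφ' : Continuous φ := (smooth_contDiff 4 0).continuous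
  have hψ' : Continuous ψ := (smooth_contDiff 4 (-3)).continuous
  have i1 : ∫ t in (0 : ℝ)..1, γ.speed (φ t) * deriv φ t = γ.length := by
    have := intervalIntegral.integral_comp_mul_deriv (a := 0) (b := 1) (f := φ) (g := γ.speed)
      (fun t _ => hφd t) hφc.continuousOn γ.continuous_speed
    rw [show φ 0 = 0 from Real.smoothTransition.zero_of_nonpos (by norm_num),
      show φ 1 = 1 from Real.smoothTransition.one_of_one_le (by norm_num)] at this
    exact this
  have i2 : ∫ t in (0 : ℝ)..1, δ.speed (ψ t) * deriv ψ t = δ.length := by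
    have := intervalIntegral.integral_comp_mul_deriv (a := 0) (b := 1) (f := ψ) (g := δ.speed)
      (fun t _ => hψd t) hψc.continuousOn δ.continuous_speed
    rw [show ψ 0 = 0 from Real.smoothTransition.zero_of_nonpos (by norm_num),
      show ψ 1 = 1 from Real.smoothTransition.one_of_one_le (by norm_num)] at this
    exact this
  rw [length]
  simp only [hspeed]
  rw [intervalIntegral.integral_add, i1, i2]
  · exact ((γ.continuous_speed.comp hφ').mul hφc).intervalIntegrable _ _
  · exact ((δ.continuous_speed.comp hψ').mul hψc).intervalIntegrable _ _

end C1Curve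

/-- `X` with the Riemannian distance induced by the Killing form. -/
instance : PseudoEMetricSpace X where
  edist := riemEDist
  edist_self p := le_antisymm
    ((iInf_le _ (C1Curve.const p)).trans (by simp [C1Curve.length_const])) bot_le
  edist_comm := by
    have h : ∀ p q : X, riemEDist p q ≤ riemEDist q p := fun p q =>
      le_iInf fun γ => (iInf_le _ γ.symm).trans (by rw [C1Curve.length_symm])
    exact fun p q => le_antisymm (h p q) (h q p)
  edist_triangle p q r := by
    change riemEDist p r ≤ riemEDist p q + riemEDist q r
    unfold riemEDist
    simp only [ENNReal.iInf_add, ENNReal.add_iInf]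
    refine le_iInf fun δ => le_iInf fun γ => (iInf_le _ (γ.trans δ)).trans ?_
    rw [C1Curve.length_trans]
    exact ENNReal.ofReal_add_le

/-! ### The plane `Y`, its geodesics and the floating planes -/

/-- The matrix of the quadratic form `F (x, y, z) = 2 x z - y²`. -/
def J : Matrix (Fin 3) (Fin 3) ℝ := !![0, 0, 1; 0, -1, 0; 1, 0, 0]

/-- The special orthogonal group `SO(F)`. -/
def SOF : Subgroup G where
  carrier := {g | g.1ᵀ * J * g.1 = J}
  one_mem' := by simp
  mul_mem' {g h} hg hh := by
    simp only [Set.mem_ofPred_eq] at hg hh ⊢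
    rw [Matrix.SpecialLinearGroup.coe_mul, Matrix.transpose_mul]
    calc h.1ᵀ * g.1ᵀ * J * (g.1 * h.1) = h.1ᵀ * (g.1ᵀ * J * g.1) * h.1 := by
          simp only [Matrix.mul_assoc]
      _ = J := by rw [hg, hh]
  inv_mem' {g} hg := by
    simp only [Set.mem_ofPred_eq] at hg ⊢
    have h1 : g.1 * (g⁻¹).1 = 1 := by
      rw [← Matrix.SpecialLinearGroup.coe_mul, mul_inv_cancel, Matrix.SpecialLinearGroup.coe_one]
    have h2 : (g⁻¹).1ᵀ * g.1ᵀ = 1 := by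
      rw [← Matrix.transpose_mul, h1, Matrix.transpose_one]
    calc (g⁻¹).1ᵀ * J * (g⁻¹).1 = (g⁻¹).1ᵀ * (g.1ᵀ * J * g.1) * (g⁻¹).1 := by rw [hg]
      _ = ((g⁻¹).1ᵀ * g.1ᵀ) * J * (g.1 * (g⁻¹).1) := by simp only [Matrix.mul_assoc]
      _ = J := by rw [h1, h2, Matrix.one_mul, Matrix.mul_one]

/-- The group `H`, the identity component of `SO(F)`. -/
def H : Subgroup G := (Subgroup.connectedComponentOfOne SOF).map SOF.subtype

/-- The totally geodesic plane `Y = H o`. -/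
def Y : Set X := {x | ∃ h ∈ H, x = h • o}

/-- The positive diagonal matrices `A` of determinant one. -/
def A : Set G := {g | ∃ d : Fin 3 → ℝ, (∀ i, 0 < d i) ∧ g.1 = Matrix.diagonal d}

/-- `A₀ = H ∩ A`. -/
def A₀ : Set G := {g | g ∈ H ∧ g ∈ A}

/-- `a t = diag (e^t, e^(-2t), e^t)`. -/
def a (t : ℝ) : G :=
  ⟨Matrix.diagonal ![Real.exp t, Real.exp (-2 * t), Real.exp t], by
    rw [Matrix.det_diagonal, Fin.prod_univ_three]
    simp only [Matrix.cons_val]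
    rw [← Real.exp_add, ← Real.exp_add, ← Real.exp_zero]
    congr 1
    ring⟩

/-- A complete geodesic of the Hadamard manifold `X`: the image of an isometric embedding of `ℝ`
(a bi-infinite geodesic parametrised by arc length). -/
def IsCompleteGeodesic (L : Set X) : Prop := ∃ c : ℝ → X, Isometry c ∧ L = Set.range c

/-- The floating geodesic plane `Y_{L,t} = h a_t Y`, where `h ∈ H` is such that `L = h A₀ o`. As
`h a_t Y` does not depend on the choice of `h`, this is written as the union over all choices. -/
def floatingPlane (L : Set X) (t : ℝ) : Set X :=
  {x | ∃ h ∈ H, L = {z | ∃ g ∈ A₀, z = h • g • o} ∧ ∃ y ∈ Y, x = h • a t • y}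

/-- `y` is a point of `S` nearest to `x`. -/
def IsNearestPoint (S : Set X) (x y : X) : Prop := y ∈ S ∧ edist x y = Metric.infEDist x S

end FloatingPlane

end

/-!
The plane `Y` is the fixed-point set of the isometric involution `p ↦ J p⁻¹ J`, where `J` is the
Gram matrix of `F`, so the point of `Y` nearest to `x` is the midpoint of `x` and its mirror image.

Midpoints in `X` are unique because the distance is controlled by the diagonal flat: up to the
scaling factor `√6 / 2`, the Iwasawa projection to the Cartan subalgebra is 1-Lipschitz on `X` and
isometric on the flat. So if `w` divides the segment between two points of the flat in a given
ratio, then its projection divides the Euclidean segment between theirs in that ratio. Applied after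
each cyclic permutation of the coordinates, this determines the diagonal entries and enough minors
of `w` to force `w` onto the flat.

By equivariance under `H` the geodesic may be taken to be `A₀ o`. In Fermi coordinates along it, `π`
sends the point of `a_t Y` with coordinate `s` to the point of `Y` with coordinate `s'` on the same
perpendicular, where `tanh (2 s') = tanh (2 s) / cosh (3 t)`. Hence `π (a_t Y)` stays within
`√3 artanh (1 / cosh (3 t))` of `A₀ o`, and this bound tends to `0` as `|t| → ∞`.
-/

namespace FloatingPlane

theorem smul_mat (g : G) (p : X) : (g • p).mat = g.1 * p.mat * g.1ᵀ := rfl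

theorem smul_mat_apply (g : G) (p : X) (i j : Fin 3) :
    (g • p).mat i j = ∑ l, (∑ k, g.1 i k * p.mat k l) * g.1 j l := rfl

theorem X.transpose_mat (p : X) : p.matᵀ = p.mat := by
  simpa only [conjTranspose_eq_transpose_of_trivial] using p.posDef.isHermitian.eq

theorem X.mat_symm (p : X) (i j : Fin 3) : p.mat i j = p.mat j i :=
  congrFun (congrFun p.transpose_mat j) i

theorem X.diag_pos (p : X) (i : Fin 3) : 0 < p.mat i i := p.posDef.diag_pos

theorem X.inv_mat (p : X) : p.mat⁻¹ = p.mat.adjugate := by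
  rw [Matrix.inv_def, p.det_eq_one, Ring.inverse_one, one_smul]

theorem X.isUnit_det (p : X) : IsUnit p.mat.det := by
  rw [p.det_eq_one]
  exact isUnit_one

/-! ### The group acts by isometries -/

theorem tangentNorm_congr (g : G) (P V : Matrix (Fin 3) (Fin 3) ℝ) :
    tangentNorm (g.1 * P * g.1ᵀ) (g.1 * V * g.1ᵀ) = tangentNorm P V := by
  have hg : IsUnit g.1.det := by rw [g.2]; exact isUnit_one
  have hgt : IsUnit g.1ᵀ.det := by rwa [det_transpose]
  have hconj : (g.1 * P * g.1ᵀ)⁻¹ * (g.1 * V * g.1ᵀ) = g.1ᵀ⁻¹ * (P⁻¹ * V) * g.1ᵀ := by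
    rw [Matrix.mul_inv_rev, Matrix.mul_inv_rev]
    simp only [Matrix.mul_assoc, nonsing_inv_mul_cancel_left _ _ hg]
  unfold tangentNorm
  congr 2
  rw [hconj, smul_pow, smul_pow, trace_smul, trace_smul, pow_two (_ * _), trace_mul_comm]
  simp only [Matrix.mul_assoc, mul_nonsing_inv_cancel_left _ _ hgt]
  rw [trace_mul_comm]
  simp only [Matrix.mul_assoc, pow_two, mul_nonsing_inv _ hgt, Matrix.mul_one]

namespace C1Curve

variable {p q : X}

theorem velocity_symm (γ : C1Curve p q) (t : ℝ) (i j : Fin 3) :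
    γ.velocity t i j = γ.velocity t j i := by
  simp only [velocity, of_apply, (γ.toFun _).mat_symm i j]

/-- The translate of a curve by a group element. -/
def translate (g : G) (γ : C1Curve p q) : C1Curve (g • p) (g • q) where
  toFun t := g • γ.toFun t
  contDiff i j := by
    have h := γ.contDiff
    simp only [smul_mat_apply]
    fun_prop
  source := by rw [γ.source]
  target := by rw [γ.target]

theorem velocity_translate (g : G) (γ : C1Curve p q) (t : ℝ) :
    (γ.translate g).velocity t = g.1 * γ.velocity t * g.1ᵀ := by
  ext i j
  refine HasDerivAt.deriv ?_
  simp only [translate, smul_mat_apply]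
  exact HasDerivAt.fun_sum fun k _ => (HasDerivAt.fun_sum fun l _ =>
    (γ.hasDerivAt t l k).const_mul _).mul_const _

theorem speed_translate (g : G) (γ : C1Curve p q) (t : ℝ) :
    (γ.translate g).speed t = γ.speed t := by
  rw [speed, velocity_translate]
  exact tangentNorm_congr g _ _

theorem length_translate (g : G) (γ : C1Curve p q) : (γ.translate g).length = γ.length := by
  simp only [length, speed_translate]

end C1Curve

theorem edist_le_ofReal_length {p q : X} (γ : C1Curve p q) :
    edist p q ≤ ENNReal.ofReal γ.length :=
  iInf_le _ γ

theorem edist_smul (g : G) (p q : X) : edist (g • p) (g • q) = edist p q := by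
  have hle (g : G) (p q : X) : edist (g • p) (g • q) ≤ edist p q := le_iInf fun γ =>
    (edist_le_ofReal_length (γ.translate g)).trans (by rw [C1Curve.length_translate])
  exact (hle g p q).antisymm (by simpa only [inv_smul_smul] using hle g⁻¹ (g • p) (g • q))

/-! ### The diagonal flat -/

/-- The space of real vectors `(d₀, d₁, d₂)` with `d₀ + d₁ + d₂ = 0` and the Euclidean norm. It
stands for the Cartan subalgebra of traceless diagonal matrices. -/
def Cartan : Submodule ℝ (EuclideanSpace ℝ (Fin 3)) where
  carrier := {d | ∑ i, d i = 0}
  zero_mem' := by simp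
  add_mem' {d e} hd he := by
    simp only [Set.mem_ofPred_eq, PiLp.add_apply, Finset.sum_add_distrib] at hd he ⊢
    rw [hd, he, add_zero]
  smul_mem' c d hd := by
    simp only [Set.mem_ofPred_eq, PiLp.smul_apply, ← Finset.smul_sum] at hd ⊢
    rw [hd, smul_zero]

theorem Cartan.sum_eq_zero (d : Cartan) : d.1 0 + d.1 1 + d.1 2 = 0 := by
  rw [← Fin.sum_univ_three]
  exact d.2

theorem Cartan.norm_eq (d : Cartan) : ‖d‖ = √(∑ i, d.1 i ^ 2) := by
  simp only [Submodule.coe_norm, EuclideanSpace.norm_eq, Real.norm_eq_abs, sq_abs]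

/-- The point `diag (e^d₀, e^d₁, e^d₂)` of `X`. -/
noncomputable def expDiag (d : Cartan) : X where
  mat := diagonal fun i => Real.exp (d.1 i)
  posDef := PosDef.diagonal fun i => Real.exp_pos _
  det_eq_one := by
    rw [det_diagonal, ← Real.exp_sum, Fin.sum_univ_three, Cartan.sum_eq_zero d, Real.exp_zero]

theorem expDiag_mat (d : Cartan) :
    (expDiag d).mat = diagonal fun i => Real.exp (d.1 i) := rfl

theorem expDiag_zero : expDiag 0 = o := by
  apply X.ext
  simp [expDiag_mat, o]

theorem tangentNorm_expDiag (d : Cartan) (V : Matrix (Fin 3) (Fin 3) ℝ) :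
    tangentNorm (expDiag d).mat V =
      √6 / 2 * √(∑ i, ∑ j, Real.exp (-d.1 i) * V i j * (Real.exp (-d.1 j) * V j i)) := by
  have hinv : (expDiag d).mat⁻¹ = diagonal fun i => Real.exp (-d.1 i) := by
    refine inv_eq_right_inv ?_
    simp only [expDiag_mat, diagonal_mul_diagonal, ← Real.exp_add, add_neg_cancel, Real.exp_zero,
      diagonal_one]
  have htrace : (((1 / 2 : ℝ) • ((expDiag d).mat⁻¹ * V)) ^ 2).trace = (1 / 2) ^ 2 *
      ∑ i, ∑ j, Real.exp (-d.1 i) * V i j * (Real.exp (-d.1 j) * V j i) := by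
    rw [smul_pow, trace_smul, smul_eq_mul, hinv, pow_two (_ * V), trace]
    simp only [diag_apply, Matrix.mul_apply (M := _ * V), diagonal_mul]
  rw [tangentNorm, htrace, ← mul_assoc, Real.sqrt_mul (by norm_num), Real.sqrt_mul (by norm_num),
    Real.sqrt_sq (by norm_num)]
  ring

theorem norm_diag_le_tangentNorm_expDiag (d : Cartan) {V : Matrix (Fin 3) (Fin 3) ℝ}
    (hV : ∀ i j, V i j = V j i) :
    √6 / 2 * √(∑ i, (Real.exp (-d.1 i) * V i i) ^ 2) ≤ tangentNorm (expDiag d).mat V := by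
  rw [tangentNorm_expDiag]
  gcongr with i
  refine le_of_eq_of_le (pow_two _) (Finset.single_le_sum
    (f := fun j => Real.exp (-d.1 i) * V i j * (Real.exp (-d.1 j) * V j i))
    (fun j _ => ?_) (Finset.mem_univ i))
  rw [hV j i, mul_mul_mul_comm, ← pow_two (V i j)]
  positivity

/-- The straight segment from `d` to `d'`, as a curve in the diagonal flat. -/
noncomputable def flatSegment (d d' : Cartan) : C1Curve (expDiag d) (expDiag d') where
  toFun t := expDiag (AffineMap.lineMap d d' t)
  contDiff i j := by
    simp only [expDiag_mat, diagonal_apply, AffineMap.lineMap_apply_module', Submodule.coe_add,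
      Submodule.coe_smul, Submodule.coe_sub, PiLp.add_apply, PiLp.smul_apply, smul_eq_mul]
    split_ifs <;> fun_prop
  source := by rw [AffineMap.lineMap_apply_zero]
  target := by rw [AffineMap.lineMap_apply_one]

theorem velocity_flatSegment (d d' : Cartan) (t : ℝ) :
    (flatSegment d d').velocity t = diagonal fun i =>
      Real.exp ((AffineMap.lineMap d d' t : Cartan).1 i) * (d' - d).1 i := by
  ext i j
  refine HasDerivAt.deriv ?_
  simp only [flatSegment, expDiag_mat, diagonal_apply, AffineMap.lineMap_apply_module',
    Submodule.coe_add, Submodule.coe_smul, PiLp.add_apply, PiLp.smul_apply, smul_eq_mul]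
  split_ifs
  · exact ((hasDerivAt_mul_const ((d' - d).1 i)).add_const (d.1 i)).exp
  · exact hasDerivAt_const t 0

theorem length_flatSegment (d d' : Cartan) :
    (flatSegment d d').length = √6 / 2 * dist d d' := by
  have hspeed (t : ℝ) : (flatSegment d d').speed t = √6 / 2 * dist d d' := by
    refine (tangentNorm_expDiag _ _).trans ?_
    rw [velocity_flatSegment, dist_comm, dist_eq_norm, Cartan.norm_eq]
    congr 3 with i
    rw [Finset.sum_eq_single i (fun j _ hij => by simp [hij.symm]) (by simp), diagonal_apply_eq,
      Real.exp_neg, inv_mul_cancel_left₀ (Real.exp_ne_zero _), pow_two]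
  simp only [C1Curve.length, hspeed, intervalIntegral.integral_const, sub_zero, one_smul]

/-! ### The Iwasawa projection -/

theorem X.minorTwo_pos (p : X) : 0 < p.mat 0 0 * p.mat 1 1 - p.mat 0 1 ^ 2 := by
  have hinv : p.mat⁻¹ 2 2 = p.mat 0 0 * p.mat 1 1 - p.mat 0 1 ^ 2 := by
    rw [p.inv_mat, adjugate_fin_three]
    simp only [p.mat_symm 1 0, of_apply, cons_val]
    ring
  exact hinv ▸ p.posDef.inv.diag_pos

/-- The Iwasawa projection: `iwasawa p` is the element `d` of the Cartan subalgebra for which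
`expDiag d` lies on the orbit of `p` under the lower unitriangular matrices. It is computed from the
leading principal minors of `p`. -/
noncomputable def iwasawa (p : X) : Cartan :=
  ⟨!₂[Real.log (p.mat 0 0),
      Real.log (p.mat 0 0 * p.mat 1 1 - p.mat 0 1 ^ 2) - Real.log (p.mat 0 0),
      -Real.log (p.mat 0 0 * p.mat 1 1 - p.mat 0 1 ^ 2)],
    by simp [Cartan, Fin.sum_univ_three]⟩

theorem iwasawa_expDiag (d : Cartan) : iwasawa (expDiag d) = d := by
  have hd := Cartan.sum_eq_zero d
  ext i
  fin_cases i
  · simp [iwasawa, expDiag_mat]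
  · simp [iwasawa, expDiag_mat, ← Real.exp_add]
  · suffices -d.1 1 + -d.1 0 = d.1 2 by simpa [iwasawa, expDiag_mat, ← Real.exp_add]
    linarith

/-- The lower unitriangular matrices. -/
def unip (x y z : ℝ) : G :=
  ⟨!![1, 0, 0; x, 1, 0; y, z, 1], by simp [det_fin_three]⟩

theorem unip_val (x y z : ℝ) : (unip x y z).1 = !![1, 0, 0; x, 1, 0; y, z, 1] := rfl

theorem iwasawa_unip_smul (x y z : ℝ) (p : X) : iwasawa (unip x y z • p) = iwasawa p := by
  have h00 : (unip x y z • p).mat 0 0 = p.mat 0 0 := by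
    simp [smul_mat_apply, unip_val, Fin.sum_univ_three]
  have h01 : (unip x y z • p).mat 0 1 = x * p.mat 0 0 + p.mat 0 1 := by
    simp [smul_mat_apply, unip_val, Fin.sum_univ_three, mul_comm]
  have h11 : (unip x y z • p).mat 1 1 = x ^ 2 * p.mat 0 0 + 2 * x * p.mat 0 1 + p.mat 1 1 := by
    simp only [smul_mat_apply, unip_val, Fin.sum_univ_three, of_apply, cons_val, p.mat_symm 1 0]
    ring
  have hminor : p.mat 0 0 * (x ^ 2 * p.mat 0 0 + 2 * x * p.mat 0 1 + p.mat 1 1) -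
      (x * p.mat 0 0 + p.mat 0 1) ^ 2 = p.mat 0 0 * p.mat 1 1 - p.mat 0 1 ^ 2 := by ring
  simp only [iwasawa, h00, h01, h11, hminor]

theorem exists_eq_unip_smul_expDiag (p : X) :
    ∃ x y z, p = unip x y z • expDiag (iwasawa p) := by
  have h0 := p.diag_pos 0
  have hm := p.minorTwo_pos
  set m := p.mat 0 0 * p.mat 1 1 - p.mat 0 1 ^ 2 with hmdef
  have hd : (expDiag (iwasawa p)).mat =
      !![p.mat 0 0, 0, 0; 0, m / p.mat 0 0, 0; 0, 0, m⁻¹] := by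
    rw [expDiag_mat, ← Matrix.diagonal_vec3]
    congr 1 with i
    fin_cases i <;>
      simp [iwasawa, ← hmdef, Real.exp_sub, Real.exp_neg, Real.exp_log h0, Real.exp_log hm]
  have hdet := p.det_eq_one
  rw [det_fin_three, p.mat_symm 1 0, p.mat_symm 2 0, p.mat_symm 2 1] at hdet
  refine ⟨p.mat 0 1 / p.mat 0 0, p.mat 0 2 / p.mat 0 0,
    (p.mat 0 0 * p.mat 1 2 - p.mat 0 1 * p.mat 0 2) / m, X.ext ?_⟩
  ext i j
  rw [smul_mat_apply, hd, unip_val]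
  fin_cases i <;> fin_cases j <;>
    simp [Fin.sum_univ_three, p.mat_symm 1 0, p.mat_symm 2 0, p.mat_symm 2 1] <;> field_simp
  · linear_combination hmdef
  · ring
  · ring
  · linear_combination p.mat 0 0 * hdet + (p.mat 2 2 * p.mat 0 0 - p.mat 0 2 ^ 2) * hmdef

namespace C1Curve

variable {p q : X} {γ : C1Curve p q} {t : ℝ} {d : Cartan}

theorem sum_velocity_of_eq_expDiag (h : γ.toFun t = expDiag d) :
    ∑ i, Real.exp (-d.1 i) * γ.velocity t i i = 0 := by
  have hγ := γ.hasDerivAt t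
  have hdet := ((((((((hγ 0 0).fun_mul (hγ 1 1)).fun_mul (hγ 2 2)).fun_sub
    (((hγ 0 0).fun_mul (hγ 1 2)).fun_mul (hγ 2 1))).fun_sub
    (((hγ 0 1).fun_mul (hγ 1 0)).fun_mul (hγ 2 2))).fun_add
    (((hγ 0 1).fun_mul (hγ 1 2)).fun_mul (hγ 2 0))).fun_add
    (((hγ 0 2).fun_mul (hγ 1 0)).fun_mul (hγ 2 1))).fun_sub
    (((hγ 0 2).fun_mul (hγ 1 1)).fun_mul (hγ 2 0)))
  have hone : HasDerivAt (fun s => (γ.toFun s).mat.det) 0 t := by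
    simp only [(γ.toFun _).det_eq_one]
    exact hasDerivAt_const _ _
  simp only [det_fin_three] at hone
  have hzero := hdet.unique hone
  have hcofactor : Real.exp (d.1 1 + d.1 2) * γ.velocity t 0 0 +
      Real.exp (d.1 0 + d.1 2) * γ.velocity t 1 1 +
      Real.exp (d.1 0 + d.1 1) * γ.velocity t 2 2 = 0 := by
    simp only [h, expDiag_mat, diagonal_apply_eq, diagonal_apply_ne, mul_zero, zero_add, zero_mul,
      add_zero, sub_zero, ne_eq, Fin.reduceEq, not_false_eq_true] at hzero
    rw [Real.exp_add, Real.exp_add, Real.exp_add]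
    linear_combination hzero
  have hd := Cartan.sum_eq_zero d
  rw [Fin.sum_univ_three, ← hcofactor]
  congr 4 <;> linarith

theorem hasDerivAt_iwasawa_of_eq_expDiag (h : γ.toFun t = expDiag d) :
    HasDerivAt (fun s => (iwasawa (γ.toFun s) : EuclideanSpace ℝ (Fin 3)))
      (WithLp.toLp 2 fun i => Real.exp (-d.1 i) * γ.velocity t i i) t := by
  have hγ := γ.hasDerivAt t
  have hlog₁ : HasDerivAt (fun s => Real.log ((γ.toFun s).mat 0 0))
      (Real.exp (-d.1 0) * γ.velocity t 0 0) t := by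
    refine ((hγ 0 0).log ((γ.toFun t).diag_pos 0).ne').congr_deriv ?_
    rw [h, expDiag_mat, diagonal_apply_eq, Real.exp_neg, div_eq_inv_mul]
  have hlog₂ : HasDerivAt (fun s => Real.log
      ((γ.toFun s).mat 0 0 * (γ.toFun s).mat 1 1 - (γ.toFun s).mat 0 1 ^ 2))
      (Real.exp (-d.1 0) * γ.velocity t 0 0 + Real.exp (-d.1 1) * γ.velocity t 1 1) t := by
    refine ((((hγ 0 0).fun_mul (hγ 1 1)).fun_sub ((hγ 0 1).fun_pow 2)).log
      (γ.toFun t).minorTwo_pos.ne').congr_deriv ?_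
    simp only [h, expDiag_mat, diagonal_apply_eq, diagonal_apply_ne _ zero_ne_one, Real.exp_neg]
    field_simp
    ring
  have hsum := sum_velocity_of_eq_expDiag h
  rw [Fin.sum_univ_three] at hsum
  refine ((PiLp.continuousLinearEquiv 2 ℝ fun _ : Fin 3 => ℝ).symm.hasFDerivAt.comp_hasDerivAt t
    (hasDerivAt_pi.2 fun i => ?_))
  fin_cases i
  · exact hlog₁
  · exact (hlog₂.sub hlog₁).congr_deriv (add_sub_cancel_left _ _)
  · exact hlog₂.neg.congr_deriv (neg_eq_of_add_eq_zero_right hsum)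

theorem exists_hasDerivAt_iwasawa (γ : C1Curve p q) (t : ℝ) :
    ∃ v, HasDerivAt (fun s => (iwasawa (γ.toFun s) : EuclideanSpace ℝ (Fin 3))) v t ∧
      √6 / 2 * ‖v‖ ≤ γ.speed t := by
  obtain ⟨x, y, z, hγt⟩ := exists_eq_unip_smul_expDiag (γ.toFun t)
  set u := unip x y z with hu
  have hiwasawa (w : X) : iwasawa (u⁻¹ • w) = iwasawa w := by
    rw [← iwasawa_unip_smul x y z (u⁻¹ • w), ← hu, smul_inv_smul]
  have hdiag : (γ.translate u⁻¹).toFun t = expDiag (iwasawa (γ.toFun t)) :=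
    inv_smul_eq_iff.2 hγt
  have hderiv := hasDerivAt_iwasawa_of_eq_expDiag hdiag
  simp only [translate, hiwasawa] at hderiv
  refine ⟨_, hderiv, ?_⟩
  rw [← speed_translate u⁻¹, speed, hdiag, EuclideanSpace.norm_eq]
  simp only [Real.norm_eq_abs, sq_abs]
  exact norm_diag_le_tangentNorm_expDiag _ ((γ.translate u⁻¹).velocity_symm t)

theorem dist_iwasawa_le_length (γ : C1Curve p q) :
    √6 / 2 * dist (iwasawa p) (iwasawa q) ≤ γ.length := by
  choose v hv hle using γ.exists_hasDerivAt_iwasawa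
  have hf (s : ℝ) : HasDerivAt (fun s =>
      (√6 / 2) • (iwasawa (γ.toFun s) - iwasawa p : EuclideanSpace ℝ (Fin 3)))
      ((√6 / 2) • v s) s := ((hv s).sub_const _).fun_const_smul _
  have hbound := image_norm_le_of_norm_deriv_right_le_deriv_boundary (a := 0) (b := 1)
    (B := fun s => ∫ t in (0 : ℝ)..s, γ.speed t)
    (fun s _ => (hf s).continuousAt.continuousWithinAt) (fun s _ => (hf s).hasDerivWithinAt)
    (by simp [γ.source]) (fun s => (γ.continuous_speed.integral_hasStrictDerivAt 0 s).hasDerivAt)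
    (fun s _ => by rw [norm_smul, Real.norm_of_nonneg (by positivity)]; exact hle s)
    (Set.right_mem_Icc.2 zero_le_one)
  rwa [norm_smul, Real.norm_of_nonneg (by positivity), γ.target, ← Submodule.coe_sub,
    ← Submodule.coe_norm, ← dist_eq_norm, dist_comm] at hbound

end C1Curve

theorem ofReal_dist_iwasawa_le_edist (p q : X) :
    ENNReal.ofReal (√6 / 2 * dist (iwasawa p) (iwasawa q)) ≤ edist p q :=
  le_iInf fun γ => ENNReal.ofReal_le_ofReal γ.dist_iwasawa_le_length

theorem edist_expDiag (d d' : Cartan) :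
    edist (expDiag d) (expDiag d') = ENNReal.ofReal (√6 / 2 * dist d d') := by
  refine le_antisymm ?_ ?_
  · rw [← length_flatSegment]
    exact edist_le_ofReal_length _
  · simpa only [iwasawa_expDiag] using ofReal_dist_iwasawa_le_edist (expDiag d) (expDiag d')

/-! ### Cartan decomposition -/

/-- The matrix of a point of `X`, as an element of `G`. -/
def X.toG (p : X) : G := ⟨p.mat, p.det_eq_one⟩

theorem X.toG_val (p : X) : p.toG.1 = p.mat := rfl

theorem toG_expDiag_smul_expDiag (d e : Cartan) :
    (expDiag d).toG • expDiag e = expDiag (e + (2 : ℝ) • d) := by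
  apply X.ext
  simp only [smul_mat, X.toG_val, expDiag_mat, diagonal_transpose, diagonal_mul_diagonal,
    ← Real.exp_add]
  refine congrArg diagonal (funext fun i => congrArg Real.exp ?_)
  simp only [Submodule.coe_add, Submodule.coe_smul, PiLp.add_apply, PiLp.smul_apply, smul_eq_mul]
  ring

theorem exists_smul_o_eq (p : X) : ∃ g : G, g • o = p := by
  obtain ⟨x, y, z, hp⟩ := exists_eq_unip_smul_expDiag p
  refine ⟨unip x y z * (expDiag ((1 / 2 : ℝ) • iwasawa p)).toG, ?_⟩
  rw [mul_smul, ← expDiag_zero, toG_expDiag_smul_expDiag, smul_smul, zero_add, mul_one_div_cancel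
    two_ne_zero, one_smul, ← hp]

theorem exists_smul_expDiag_eq (p : X) : ∃ (r : G) (d : Cartan), r • o = o ∧ r • expDiag d = p := by
  have hp := p.posDef.isHermitian
  set U := hp.eigenvectorUnitary.1
  have hUU : U * Uᵀ = 1 := mem_unitaryGroup_iff.1 hp.eigenvectorUnitary.2
  have hdet : U.det * U.det = 1 := by
    simpa only [det_mul, det_transpose, det_one] using congrArg det hUU
  have hspectral : U * diagonal hp.eigenvalues * Uᵀ = p.mat := hp.spectral_theorem.symm
  have hsum : ∑ i, Real.log (hp.eigenvalues i) = 0 := by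
    rw [← Real.log_prod fun i _ => (p.posDef.eigenvalues_pos i).ne']
    have hprod := hp.det_eq_prod_eigenvalues
    rw [p.det_eq_one] at hprod
    simp only [RCLike.ofReal_real_eq_id, id_eq] at hprod
    rw [← hprod, Real.log_one]
  -- In odd dimension the sign of `U` can be chosen so that its determinant is one.
  obtain ⟨r, hrU⟩ : ∃ r : G, r.1 = U.det • U := by
    refine ⟨⟨U.det • U, ?_⟩, rfl⟩
    rw [det_smul, Fintype.card_fin]
    linear_combination (U.det * U.det + 1) * hdet
  have hr (q : X) : (r • q).mat = U * q.mat * Uᵀ := by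
    simp only [smul_mat, hrU, transpose_smul, Matrix.smul_mul, Matrix.mul_smul, smul_smul, hdet,
      one_smul]
  refine ⟨r, ⟨WithLp.toLp 2 fun i => Real.log (hp.eigenvalues i), hsum⟩, X.ext ?_, X.ext ?_⟩
  · rw [hr, o, Matrix.mul_one, hUU]
  · refine (hr _).trans (Eq.trans ?_ hspectral)
    rw [expDiag_mat]
    congr with i
    exact Real.exp_log (p.posDef.eigenvalues_pos i)

theorem exists_smul_o_eq_and_smul_expDiag_eq (p q : X) :
    ∃ (g : G) (d : Cartan), g • o = p ∧ g • expDiag d = q := by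
  obtain ⟨g, hg⟩ := exists_smul_o_eq p
  obtain ⟨r, d, hro, hrd⟩ := exists_smul_expDiag_eq (g⁻¹ • q)
  exact ⟨g * r, d, by rw [mul_smul, hro, hg], by rw [mul_smul, hrd, smul_inv_smul]⟩

/-! ### The metric space `X` -/

instance : IsIsometricSMul G X := ⟨edist_smul⟩

theorem edist_ne_top (p q : X) : edist p q ≠ ⊤ := by
  obtain ⟨g, d, rfl, rfl⟩ := exists_smul_o_eq_and_smul_expDiag_eq p q
  rw [edist_smul, ← expDiag_zero, edist_expDiag]
  exact ENNReal.ofReal_ne_top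

noncomputable instance : PseudoMetricSpace X := PseudoEMetricSpace.toPseudoMetricSpace edist_ne_top

theorem dist_expDiag (d d' : Cartan) : dist (expDiag d) (expDiag d') = √6 / 2 * dist d d' := by
  rw [dist_edist, edist_expDiag, ENNReal.toReal_ofReal (by positivity)]

theorem dist_iwasawa_le (p q : X) : √6 / 2 * dist (iwasawa p) (iwasawa q) ≤ dist p q := by
  rw [dist_edist p q, ← ENNReal.ofReal_le_iff_le_toReal (edist_ne_top p q)]
  exact ofReal_dist_iwasawa_le_edist p q

noncomputable instance : MetricSpace X where
  eq_of_dist_eq_zero {p q} h := by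
    obtain ⟨g, d, rfl, rfl⟩ := exists_smul_o_eq_and_smul_expDiag_eq p q
    rw [dist_smul, ← expDiag_zero, dist_expDiag] at h
    rw [← expDiag_zero, dist_eq_zero.1 ((mul_eq_zero.1 h).resolve_left (by positivity))]

/-! ### Points on geodesic segments are determined by their distances to the end points -/

theorem iwasawa_eq_lineMap_of_dist_eq_mul {d d' : Cartan} {w : X} {τ : ℝ}
    (h : dist (expDiag d) w = τ * dist (expDiag d) (expDiag d'))
    (h' : dist w (expDiag d') = (1 - τ) * dist (expDiag d) (expDiag d')) :
    iwasawa w = AffineMap.lineMap d d' τ := by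
  have hle := dist_iwasawa_le (expDiag d) w
  have hle' := dist_iwasawa_le w (expDiag d')
  rw [iwasawa_expDiag, h, dist_expDiag, mul_left_comm] at hle
  rw [iwasawa_expDiag, h', dist_expDiag, mul_left_comm] at hle'
  have h6 : (0 : ℝ) < √6 / 2 := by positivity
  have hle := le_of_mul_le_mul_left hle h6
  have hle' := le_of_mul_le_mul_left hle' h6
  have htri := dist_triangle d (iwasawa w) d'
  exact eq_lineMap_of_dist_eq_mul_of_dist_eq_mul (by linarith) (by linarith)

theorem mat_zero_zero_eq_of_iwasawa_eq {p q : X} (h : iwasawa p = iwasawa q) :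
    p.mat 0 0 = q.mat 0 0 :=
  Real.log_injOn_pos (p.diag_pos 0) (q.diag_pos 0) (congrArg (fun d : Cartan => d.1 0) h)

theorem minorTwo_eq_of_iwasawa_eq {p q : X} (h : iwasawa p = iwasawa q) :
    p.mat 0 0 * p.mat 1 1 - p.mat 0 1 ^ 2 = q.mat 0 0 * q.mat 1 1 - q.mat 0 1 ^ 2 :=
  Real.log_injOn_pos p.minorTwo_pos q.minorTwo_pos
    (neg_injective (congrArg (fun d : Cartan => d.1 2) h))

/-- The permutation matrix of the cyclic permutation `i ↦ i + 1`. -/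
def cyc : G := ⟨!![0, 1, 0; 0, 0, 1; 1, 0, 0], by simp [det_fin_three]⟩

theorem cyc_smul_mat (p : X) (i j : Fin 3) : (cyc • p).mat i j = p.mat (i + 1) (j + 1) := by
  rw [smul_mat_apply]
  fin_cases i <;> fin_cases j <;> simp [cyc, Fin.sum_univ_three]

theorem exists_cyc_smul_expDiag (d : Cartan) : ∃ e, cyc • expDiag d = expDiag e := by
  refine ⟨⟨WithLp.toLp 2 fun i => d.1 (i + 1), ?_⟩, X.ext ?_⟩
  · exact (Equiv.sum_comp (Equiv.addRight 1) d.1).trans d.2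
  · ext i j
    simp only [cyc_smul_mat, expDiag_mat, diagonal_apply, add_left_inj]

theorem eq_expDiag_of_iwasawa_eq {w : X} {e : Cartan}
    (h : ∀ k : ℕ, iwasawa (cyc ^ k • w) = iwasawa (cyc ^ k • expDiag e)) : w = expDiag e := by
  have hmat (k : ℕ) (p : X) (i j : Fin 3) :
      (cyc ^ k • p).mat i j = p.mat (i + k • 1) (j + k • 1) := by
    induction k generalizing i j with
    | zero => rw [pow_zero, one_smul, zero_smul, add_zero, add_zero]
    | succ k ih => rw [pow_succ', mul_smul, cyc_smul_mat, ih, succ_nsmul', add_assoc, add_assoc]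
  have hk (k : Fin 3) : k.1 • (1 : Fin 3) = k := by decide +revert
  have hdiag (k : Fin 3) : w.mat k k = (expDiag e).mat k k := by
    simpa only [hmat, hk, zero_add] using mat_zero_zero_eq_of_iwasawa_eq (h k)
  have hoff (k : Fin 3) : w.mat k (k + 1) = 0 := by
    have hminor := minorTwo_eq_of_iwasawa_eq (h k)
    simp only [hmat, hk, zero_add, hdiag, add_comm 1 k] at hminor
    rw [expDiag_mat, diagonal_apply_ne _ (by simp : k ≠ k + 1)] at hminor
    exact pow_eq_zero_iff two_ne_zero |>.1 (by linarith)
  apply X.ext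
  ext i j
  obtain rfl | rfl | rfl : j = i ∨ j = i + 1 ∨ i = j + 1 := by decide +revert
  · exact hdiag j
  · rw [hoff, expDiag_mat, diagonal_apply_ne _ (by simp)]
  · rw [w.mat_symm, hoff, expDiag_mat, diagonal_apply_ne _ (by simp)]

theorem eq_expDiag_of_dist_eq_mul {d d' : Cartan} {w : X} {τ : ℝ} (hτ : τ ∈ Set.Icc 0 1)
    (h : dist (expDiag d) w = τ * dist (expDiag d) (expDiag d'))
    (h' : dist w (expDiag d') = (1 - τ) * dist (expDiag d) (expDiag d')) :
    w = expDiag (AffineMap.lineMap d d' τ) := by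
  have hτ₀ : 0 ≤ τ := hτ.1
  have hτ₁ : 0 ≤ 1 - τ := sub_nonneg.2 hτ.2
  set m := expDiag (AffineMap.lineMap d d' τ)
  have hm : dist (expDiag d) m = τ * dist (expDiag d) (expDiag d') := by
    rw [dist_expDiag, dist_expDiag, dist_left_lineMap, Real.norm_of_nonneg hτ₀, mul_left_comm]
  have hm' : dist m (expDiag d') = (1 - τ) * dist (expDiag d) (expDiag d') := by
    rw [dist_expDiag, dist_expDiag, dist_lineMap_right, Real.norm_of_nonneg hτ₁, mul_left_comm]
  have hcyc (d : Cartan) (k : ℕ) : ∃ e, cyc ^ k • expDiag d = expDiag e := by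
    induction k with
    | zero => exact ⟨d, by rw [pow_zero, one_smul]⟩
    | succ k ih =>
      obtain ⟨e, he⟩ := ih
      rw [pow_succ', mul_smul, he]
      exact exists_cyc_smul_expDiag e
  refine eq_expDiag_of_iwasawa_eq fun k => ?_
  obtain ⟨e, he⟩ := hcyc d k
  obtain ⟨e', he'⟩ := hcyc d' k
  rw [← dist_smul (cyc ^ k), ← dist_smul (cyc ^ k) (expDiag d) (expDiag d'), he] at h hm
  rw [← dist_smul (cyc ^ k), ← dist_smul (cyc ^ k) (expDiag d) (expDiag d'), he'] at h' hm'
  rw [he'] at h hm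
  rw [he] at h' hm'
  rw [iwasawa_eq_lineMap_of_dist_eq_mul h h', iwasawa_eq_lineMap_of_dist_eq_mul hm hm']

theorem eq_of_dist_eq_mul {p q w w' : X} {τ : ℝ} (hτ : τ ∈ Set.Icc 0 1)
    (hpw : dist p w = τ * dist p q) (hwq : dist w q = (1 - τ) * dist p q)
    (hpw' : dist p w' = τ * dist p q) (hwq' : dist w' q = (1 - τ) * dist p q) : w = w' := by
  obtain ⟨g, d, rfl, rfl⟩ := exists_smul_o_eq_and_smul_expDiag_eq p q
  have hunique {w : X} (hpw : dist (g • o) w = τ * dist (g • o) (g • expDiag d))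
      (hwq : dist w (g • expDiag d) = (1 - τ) * dist (g • o) (g • expDiag d)) :
      g⁻¹ • w = expDiag (AffineMap.lineMap 0 d τ) := by
    rw [← smul_inv_smul g w, dist_smul, dist_smul, ← expDiag_zero] at hpw hwq
    exact eq_expDiag_of_dist_eq_mul hτ hpw hwq
  exact smul_left_cancel g⁻¹ ((hunique hpw hwq).trans (hunique hpw' hwq').symm)

/-! ### Geodesic symmetries -/

noncomputable instance : Inv X where
  inv p :=
    { mat := p.mat⁻¹
      posDef := p.posDef.inv
      det_eq_one := by rw [det_nonsing_inv, p.det_eq_one, Ring.inverse_one] }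

theorem inv_mat (p : X) : p⁻¹.mat = p.mat⁻¹ := rfl

theorem coe_inv_G (g : G) : g⁻¹.1 = g.1⁻¹ := by
  have hg : g.1 * (g⁻¹).1 = 1 := by
    rw [← Matrix.SpecialLinearGroup.coe_mul, mul_inv_cancel, Matrix.SpecialLinearGroup.coe_one]
  exact (inv_eq_right_inv hg).symm

theorem smul_inv_eq (g : G) (p : X) : (g • p)⁻¹ = g⁻¹.transpose • p⁻¹ := by
  apply X.ext
  simp only [inv_mat, smul_mat, Matrix.mul_inv_rev, ← transpose_nonsing_inv, coe_inv_G,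
    Matrix.SpecialLinearGroup.coe_transpose, transpose_transpose, Matrix.mul_assoc]

theorem inv_expDiag (d : Cartan) : (expDiag d)⁻¹ = expDiag (-d) := by
  refine X.ext (inv_eq_right_inv ?_)
  simp only [expDiag_mat, diagonal_mul_diagonal, ← Real.exp_add, Submodule.coe_neg,
    PiLp.neg_apply, add_neg_cancel, Real.exp_zero, diagonal_one]

theorem inv_o : o⁻¹ = o := by
  rw [← expDiag_zero, inv_expDiag, neg_zero]

theorem dist_inv (p q : X) : dist p⁻¹ q⁻¹ = dist p q := by
  obtain ⟨g, d, rfl, rfl⟩ := exists_smul_o_eq_and_smul_expDiag_eq p q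
  rw [smul_inv_eq, smul_inv_eq, dist_smul, dist_smul, inv_expDiag, inv_o, ← expDiag_zero,
    dist_expDiag, dist_expDiag, dist_zero_left, dist_zero_left, norm_neg]

/-- The geodesic symmetry of `X` at `m`, that is, the isometric involution that fixes `m` and
reverses the geodesics through `m`; on matrices it is `p ↦ m p⁻¹ m`. -/
noncomputable def geodesicSymmetry (m p : X) : X := m.toG • p⁻¹

theorem geodesicSymmetry_smul_smul (g : G) (m p : X) :
    geodesicSymmetry (g • m) (g • p) = g • geodesicSymmetry m p := by
  have hG : (g • m).toG * g⁻¹.transpose = g * m.toG := by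
    have hgg : g.1ᵀ * g⁻¹.1ᵀ = 1 := by
      rw [← transpose_mul, ← Matrix.SpecialLinearGroup.coe_mul, inv_mul_cancel,
        Matrix.SpecialLinearGroup.coe_one, transpose_one]
    ext1
    simp only [Matrix.SpecialLinearGroup.coe_mul, X.toG_val, smul_mat,
      Matrix.SpecialLinearGroup.coe_transpose, Matrix.mul_assoc, hgg, Matrix.mul_one]
  rw [geodesicSymmetry, smul_inv_eq, smul_smul, hG, mul_smul, geodesicSymmetry]

theorem geodesicSymmetry_o (p : X) : geodesicSymmetry o p = p⁻¹ := by
  have ho : o.toG = 1 := rfl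
  rw [geodesicSymmetry, ho, one_smul]

theorem dist_geodesicSymmetry (m p : X) : dist m (geodesicSymmetry m p) = dist p m := by
  obtain ⟨g, d, rfl, rfl⟩ := exists_smul_o_eq_and_smul_expDiag_eq m p
  rw [geodesicSymmetry_smul_smul, geodesicSymmetry_o, dist_smul, dist_smul, inv_expDiag,
    ← expDiag_zero, dist_expDiag, dist_expDiag, dist_zero_left, dist_zero_right, norm_neg]

theorem dist_self_geodesicSymmetry (m p : X) :
    dist p (geodesicSymmetry m p) = 2 * dist p m := by
  obtain ⟨g, d, rfl, rfl⟩ := exists_smul_o_eq_and_smul_expDiag_eq m p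
  rw [geodesicSymmetry_smul_smul, geodesicSymmetry_o, dist_smul, dist_smul, inv_expDiag,
    ← expDiag_zero, dist_expDiag, dist_expDiag, dist_zero_right, dist_eq_norm, sub_neg_eq_add,
    ← two_smul ℝ d, norm_smul, Real.norm_two, mul_left_comm]

theorem exists_geodesicSymmetry_eq (p q : X) : ∃ m, geodesicSymmetry m p = q := by
  obtain ⟨g, d, rfl, rfl⟩ := exists_smul_o_eq_and_smul_expDiag_eq p q
  refine ⟨g • expDiag ((1 / 2 : ℝ) • d), ?_⟩
  rw [geodesicSymmetry_smul_smul, geodesicSymmetry, inv_o, ← expDiag_zero, toG_expDiag_smul_expDiag,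
    smul_smul, mul_one_div_cancel two_ne_zero, one_smul, zero_add]

theorem eq_of_dist_eq_half {p q m m' : X} (hpm : dist p m = 1 / 2 * dist p q)
    (hmq : dist m q = 1 / 2 * dist p q) (hpm' : dist p m' = 1 / 2 * dist p q)
    (hmq' : dist m' q = 1 / 2 * dist p q) : m = m' :=
  eq_of_dist_eq_mul (by norm_num) hpm (by linarith) hpm' (by linarith)

theorem geodesicSymmetry_eq_iff {m p q : X} : geodesicSymmetry m p = q ↔
    dist p m = 1 / 2 * dist p q ∧ dist m q = 1 / 2 * dist p q := by
  have hmid (m p : X) : dist p m = 1 / 2 * dist p (geodesicSymmetry m p) ∧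
      dist m (geodesicSymmetry m p) = 1 / 2 * dist p (geodesicSymmetry m p) := by
    rw [dist_geodesicSymmetry, dist_self_geodesicSymmetry]
    constructor <;> ring
  refine ⟨fun h => h ▸ hmid m p, fun ⟨hpm, hmq⟩ => ?_⟩
  obtain ⟨n, rfl⟩ := exists_geodesicSymmetry_eq p q
  rw [eq_of_dist_eq_half hpm hmq (hmid n p).1 (hmid n p).2]

theorem geodesicSymmetry_left_injective (p : X) :
    Function.Injective fun m => geodesicSymmetry m p := fun m n h => by
  obtain ⟨hm, hm'⟩ := geodesicSymmetry_eq_iff.1 h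
  obtain ⟨hn, hn'⟩ := geodesicSymmetry_eq_iff.1 (rfl : geodesicSymmetry n p = _)
  exact eq_of_dist_eq_half hm hm' hn hn'

/-! ### The reflection in `Y` -/

theorem J_transpose : Jᵀ = J := by
  ext i j
  fin_cases i <;> fin_cases j <;> rfl

theorem J_mul_J : J * J = 1 := by
  simp [J, one_fin_three]

theorem mul_J_mul_transpose {g : G} (hg : g ∈ SOF) : g.1 * J * g.1ᵀ = J := by
  have hleft : (J * g.1ᵀ * J) * g.1 = 1 := by
    rw [Matrix.mul_assoc, Matrix.mul_assoc, ← Matrix.mul_assoc g.1ᵀ,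
      show g.1ᵀ * J * g.1 = J from hg, J_mul_J]
  have hright : g.1 * J * g.1ᵀ * J = 1 := by
    simpa only [Matrix.mul_assoc] using mul_eq_one_comm.1 hleft
  rw [← Matrix.mul_one (_ * g.1ᵀ), ← J_mul_J, ← Matrix.mul_assoc, hright, Matrix.one_mul]

/-- The matrix `J`, as an element of `G`. -/
def toG_J : G := ⟨J, by simp [J, det_fin_three]⟩

theorem toG_J_val : toG_J.1 = J := rfl

theorem toG_J_mem_SOF : toG_J ∈ SOF := by
  change Jᵀ * J * J = J
  rw [J_transpose, J_mul_J, Matrix.one_mul]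

/-- The isometric involution `p ↦ J p⁻¹ J` of `X`; its fixed-point set is the plane `Y`. -/
noncomputable def reflection (p : X) : X := toG_J • p⁻¹

theorem reflection_smul {h : G} (hh : h ∈ SOF) (p : X) : reflection (h • p) = h • reflection p := by
  have hmul : toG_J * h⁻¹.transpose = h * toG_J := by
    rw [← inv_mul_eq_iff_eq_mul, ← mul_assoc]
    exact Subtype.ext (mul_J_mul_transpose (inv_mem hh))
  rw [reflection, smul_inv_eq, smul_smul, hmul, mul_smul, reflection]

theorem reflection_o : reflection o = o := by
  apply X.ext
  rw [reflection, inv_o, smul_mat, toG_J_val, J_transpose, o, Matrix.mul_one, J_mul_J]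

theorem reflection_reflection (p : X) : reflection (reflection p) = p := by
  have hJJ : toG_J * toG_J = 1 := Subtype.ext J_mul_J
  have hinv : p⁻¹⁻¹ = p := X.ext (nonsing_inv_nonsing_inv _ p.isUnit_det)
  rw [reflection.eq_1 p, reflection_smul toG_J_mem_SOF, reflection, smul_smul, hJJ, one_smul, hinv]

theorem dist_reflection (p q : X) : dist (reflection p) (reflection q) = dist p q := by
  rw [reflection, reflection, dist_smul, dist_inv]

theorem H_le_SOF : H ≤ SOF := by
  rintro _ ⟨g, -, rfl⟩
  exact g.2

theorem smul_mem_Y {h : G} (hh : h ∈ H) {y : X} (hy : y ∈ Y) : h • y ∈ Y := by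
  obtain ⟨g, hg, rfl⟩ := hy
  exact ⟨h * g, mul_mem hh hg, smul_smul h g o⟩

theorem reflection_eq_of_mem_Y {y : X} (hy : y ∈ Y) : reflection y = y := by
  obtain ⟨h, hh, rfl⟩ := hy
  rw [reflection_smul (H_le_SOF hh), reflection_o]

/-! ### The hyperboloid model of `Y` -/

/-- The point `v` of the hyperboloid `F = 1`, where `F v = 2 v₀ v₂ - v₁²`, represents the point
`2 v vᵀ - J` of `Y`. -/
def Represents (v : Fin 3 → ℝ) (y : X) : Prop :=
  2 * v 0 * v 2 - v 1 ^ 2 = 1 ∧ y.mat = (2 : ℝ) • vecMulVec v v - J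

theorem Represents.unique {v : Fin 3 → ℝ} {y y' : X} (h : Represents v y)
    (h' : Represents v y') : y = y' :=
  X.ext (h.2.trans h'.2.symm)

theorem Represents.smul {v : Fin 3 → ℝ} {y : X} (h : Represents v y) {g : G} (hg : g ∈ SOF) :
    Represents (g.1 *ᵥ v) (g • y) := by
  have hF (v : Fin 3 → ℝ) : 2 * v 0 * v 2 - v 1 ^ 2 = v ⬝ᵥ (J *ᵥ v) := by
    simp only [J, mulVec, dotProduct, Fin.sum_univ_three, of_apply, cons_val]
    ring
  refine ⟨?_, ?_⟩
  · rw [hF, dotProduct_mulVec, vecMul_mulVec, ← dotProduct_mulVec, mulVec_mulVec,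
      show g.1ᵀ * J * g.1 = J from hg, ← hF, h.1]
  · rw [smul_mat, h.2, Matrix.mul_sub, Matrix.sub_mul, mul_J_mul_transpose hg, Matrix.mul_smul,
      Matrix.smul_mul, mul_vecMulVec, vecMulVec_mul, vecMul_transpose]

theorem represents_o : Represents ![√2 / 2, 0, √2 / 2] o := by
  have h2 : √(2 : ℝ) ^ 2 = 2 := Real.sq_sqrt zero_le_two
  refine ⟨?_, ?_⟩
  · simp only [cons_val]
    linear_combination h2 / 2
  · have h : 2 * (√(2 : ℝ) / 2 * (√2 / 2)) = 1 := by linear_combination h2 / 2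
    ext i j
    fin_cases i <;> fin_cases j <;> simp [o, J, h]

theorem reflection_mat (p : X) : (reflection p).mat =
    !![p.mat 0 0 * p.mat 1 1 - p.mat 0 1 ^ 2, p.mat 0 0 * p.mat 1 2 - p.mat 0 1 * p.mat 0 2,
        p.mat 0 1 * p.mat 1 2 - p.mat 0 2 * p.mat 1 1;
      p.mat 0 0 * p.mat 1 2 - p.mat 0 1 * p.mat 0 2, p.mat 0 0 * p.mat 2 2 - p.mat 0 2 ^ 2,
        p.mat 0 1 * p.mat 2 2 - p.mat 0 2 * p.mat 1 2;
      p.mat 0 1 * p.mat 1 2 - p.mat 0 2 * p.mat 1 1, p.mat 0 1 * p.mat 2 2 - p.mat 0 2 * p.mat 1 2,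
        p.mat 1 1 * p.mat 2 2 - p.mat 1 2 ^ 2] := by
  rw [reflection, smul_mat, inv_mat, p.inv_mat, toG_J_val, J_transpose, J, adjugate_fin_three,
    p.mat_symm 1 0, p.mat_symm 2 0, p.mat_symm 2 1]
  ext i j
  fin_cases i <;> fin_cases j <;> simp <;> ring

theorem exists_represents_of_reflection_eq {y : X} (hy : reflection y = y) :
    ∃ v, 0 < v 0 ∧ 0 < v 2 ∧ Represents v y := by
  have hmat (i j : Fin 3) := congrFun₂ (hy ▸ reflection_mat y) i j
  have h02 := hmat 0 2
  have h11 := hmat 1 1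
  have h12 := hmat 1 2
  have h22 := hmat 2 2
  simp only [of_apply, cons_val] at h02 h11 h12 h22
  have hpos := y.diag_pos 2
  have h11' : y.mat 1 1 = 2 * y.mat 0 2 + 1 :=
    mul_left_cancel₀ hpos.ne' <| by
      linear_combination -(y.mat 0 2 + 1) * h22 - y.mat 2 2 * h02 + y.mat 1 2 * h12
  set c := √(y.mat 2 2 / 2)
  have hc : 0 < c := Real.sqrt_pos.2 (half_pos hpos)
  have hc2 : c ^ 2 = y.mat 2 2 / 2 := Real.sq_sqrt (half_pos hpos).le
  have h02pos : 0 < y.mat 0 2 + 1 := by linarith [y.diag_pos 1]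
  refine ⟨![(y.mat 0 2 + 1) / (2 * c), y.mat 1 2 / (2 * c), c], ?_, ?_, ?_, ?_⟩
  · simp only [cons_val]; positivity
  · simpa only [cons_val]
  · simp only [cons_val]
    field_simp
    linear_combination 4 * y.mat 0 2 * hc2 - h22 - y.mat 2 2 * h11'
  · ext i j
    fin_cases i <;> fin_cases j <;>
      simp [J, y.mat_symm 1 0, y.mat_symm 2 0, y.mat_symm 2 1] <;> field_simp
    · linear_combination 2 * y.mat 0 0 * hc2 - h11 + h11'
    · linear_combination 2 * y.mat 0 1 * hc2 - h12
    · ring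
    · linear_combination 2 * y.mat 0 1 * hc2 - h12
    · linear_combination 2 * (y.mat 1 1 - 1) * hc2 - h22
    · ring
    · linear_combination -2 * hc2

/-! ### One-parameter subgroups of `H` -/

theorem mem_H_of_continuous {f : ℝ → Matrix (Fin 3) (Fin 3) ℝ} (hf : Continuous f)
    (hdet : ∀ s, (f s).det = 1) (hJ : ∀ s, (f s)ᵀ * J * f s = J) (h0 : f 0 = 1) (s : ℝ) :
    (⟨f s, hdet s⟩ : G) ∈ H := by
  let φ (s : ℝ) : SOF := ⟨⟨f s, hdet s⟩, hJ s⟩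
  have hφ : Continuous φ := (hf.subtype_mk _).subtype_mk _
  exact ⟨φ s, (isPreconnected_range hφ).subset_connectedComponent
    ⟨0, Subtype.ext (Subtype.ext h0)⟩ ⟨s, rfl⟩, rfl⟩

/-- The one-parameter subgroup `diag (e^s, 1, e^(-s))` of `H`, whose elements translate `Y` along
the geodesic `A₀ o`. -/
noncomputable def boost (s : ℝ) : G :=
  ⟨diagonal ![Real.exp s, 1, Real.exp (-s)], by
    rw [det_diagonal, Fin.prod_univ_three]
    simp only [cons_val, mul_one, ← Real.exp_add, add_neg_cancel, Real.exp_zero]⟩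

theorem boost_val (s : ℝ) : (boost s).1 = diagonal ![Real.exp s, 1, Real.exp (-s)] := rfl

theorem boost_mem_H (s : ℝ) : boost s ∈ H := by
  refine mem_H_of_continuous (f := fun s => diagonal ![Real.exp s, 1, Real.exp (-s)]) ?_
    (fun s => (boost s).2) (fun s => ?_) ?_ s
  · refine Continuous.matrix_diagonal (continuous_pi fun i => ?_)
    fin_cases i
    · exact Real.continuous_exp
    · exact continuous_const
    · exact Real.continuous_exp.comp continuous_neg
  · ext i j
    fin_cases i <;> fin_cases j <;> simp [J, mul_apply, diagonal_apply, ← Real.exp_add]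
  · simp [diagonal_vec3, one_fin_three]

theorem boost_zero : boost 0 = 1 := by
  ext1
  simp [boost_val, diagonal_vec3, one_fin_three]

theorem mem_A₀_iff {g : G} : g ∈ A₀ ↔ ∃ s, g = boost s := by
  constructor
  · rintro ⟨hH, d, hd, hgd⟩
    have hJ : g.1ᵀ * J * g.1 = J := H_le_SOF hH
    have h02 : d 0 * d 2 = 1 := by
      simpa [hgd, J, mul_apply, diagonal_apply] using congrFun₂ hJ 0 2
    have h11 : d 1 * d 1 = 1 := by
      simpa [hgd, J, mul_apply, diagonal_apply] using congrFun₂ hJ 1 1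
    refine ⟨Real.log (d 0), Subtype.ext ?_⟩
    rw [hgd, boost_val, Real.exp_neg, Real.exp_log (hd 0)]
    congr 1
    ext i
    fin_cases i
    · rfl
    · exact (mul_self_eq_one_iff.1 h11).resolve_right (by linarith [hd 1])
    · exact eq_inv_of_mul_eq_one_right h02
  · rintro ⟨s, rfl⟩
    refine ⟨boost_mem_H s, ![Real.exp s, 1, Real.exp (-s)], fun i => ?_, rfl⟩
    fin_cases i <;> simp [Real.exp_pos]

theorem dist_boost_smul_o (s t : ℝ) : dist (boost s • o) (boost t • o) = 2 * √3 * |s - t| := by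
  let δ : Cartan := ⟨!₂[1, 0, -1], by simp [Cartan, Fin.sum_univ_three]⟩
  have hδ : ‖δ‖ = √2 := by
    rw [Cartan.norm_eq, Fin.sum_univ_three]
    change √((1 : ℝ) ^ 2 + 0 ^ 2 + (-1) ^ 2) = √2
    norm_num
  have h (s : ℝ) : boost s • o = expDiag ((2 * s) • δ) := by
    apply X.ext
    rw [smul_mat, boost_val, expDiag_mat]
    ext i j
    fin_cases i <;> fin_cases j <;> simp [o, δ, two_mul, Real.exp_add]
  have h62 : √(6 : ℝ) * √2 = 2 * √3 := by
    rw [← Real.sqrt_mul (by norm_num), show (6 : ℝ) * 2 = 2 ^ 2 * 3 by norm_num,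
      Real.sqrt_mul (by norm_num), Real.sqrt_sq zero_le_two]
  rw [h, h, dist_expDiag, dist_eq_norm, ← sub_smul, norm_smul, hδ, ← mul_sub, Real.norm_eq_abs,
    abs_mul, abs_two]
  linear_combination |s - t| * h62

/-- The one-parameter subgroup of `H` consisting of the rotations of `Y` about `o`. -/
noncomputable def rot (θ : ℝ) : G :=
  ⟨!![(1 + Real.cos θ) / 2, -(√2 / 2 * Real.sin θ), (1 - Real.cos θ) / 2;
      √2 / 2 * Real.sin θ, Real.cos θ, -(√2 / 2 * Real.sin θ);
      (1 - Real.cos θ) / 2, √2 / 2 * Real.sin θ, (1 + Real.cos θ) / 2], by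
    have h2 : √(2 : ℝ) ^ 2 = 2 := Real.sq_sqrt zero_le_two
    simp only [det_fin_three, of_apply, cons_val]
    linear_combination (1 / 2 * Real.sin θ ^ 2) * h2 + Real.sin_sq_add_cos_sq θ⟩

theorem rot_val (θ : ℝ) : (rot θ).1 =
    !![(1 + Real.cos θ) / 2, -(√2 / 2 * Real.sin θ), (1 - Real.cos θ) / 2;
      √2 / 2 * Real.sin θ, Real.cos θ, -(√2 / 2 * Real.sin θ);
      (1 - Real.cos θ) / 2, √2 / 2 * Real.sin θ, (1 + Real.cos θ) / 2] := rfl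

theorem rot_mem_H (θ : ℝ) : rot θ ∈ H := by
  refine mem_H_of_continuous (f := fun θ => (rot θ).1) ?_ (fun θ => (rot θ).2) (fun θ => ?_) ?_ θ
  · refine continuous_matrix fun i j => ?_
    fin_cases i <;> fin_cases j <;>
      simp only [rot_val, of_apply, Fin.zero_eta, Fin.mk_one, Fin.reduceFinMk, cons_val] <;>
      fun_prop
  · have h2 : √(2 : ℝ) ^ 2 = 2 := Real.sq_sqrt zero_le_two
    have hθ := Real.sin_sq_add_cos_sq θ
    ext i j
    fin_cases i <;> fin_cases j <;> simp [rot_val, J, mul_apply, Fin.sum_univ_three] <;> grind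
  · simp [rot_val, one_fin_three]

theorem Represents.boost_smul {v : Fin 3 → ℝ} {y : X} (h : Represents v y) (s : ℝ) :
    Represents ![Real.exp s * v 0, v 1, Real.exp (-s) * v 2] (boost s • y) := by
  convert h.smul (H_le_SOF (boost_mem_H s)) using 1
  ext i
  fin_cases i <;> simp [boost_val, mulVec_diagonal]

theorem represents_rot_boost_smul_o (θ s : ℝ) :
    Represents ![√2 / 2 * (Real.cosh s + Real.cos θ * Real.sinh s), Real.sin θ * Real.sinh s,
      √2 / 2 * (Real.cosh s - Real.cos θ * Real.sinh s)] (rot θ • boost s • o) := by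
  have h2 : √(2 : ℝ) ^ 2 = 2 := Real.sq_sqrt zero_le_two
  convert (represents_o.boost_smul s).smul (H_le_SOF (rot_mem_H θ)) using 1
  ext i
  fin_cases i <;>
    simp only [rot_val, mulVec, dotProduct, Fin.sum_univ_three, of_apply, Fin.zero_eta, Fin.mk_one,
      Fin.reduceFinMk, cons_val, Real.cosh_eq, Real.sinh_eq]
  · ring
  · linear_combination -(Real.sin θ * (Real.exp s - Real.exp (-s)) / 4) * h2
  · ring

theorem rot_smul_o (θ : ℝ) : rot θ • o = o := by
  have h (θ : ℝ) := represents_rot_boost_smul_o θ 0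
  simp only [Real.cosh_zero, Real.sinh_zero, mul_zero, add_zero, sub_zero, mul_one, boost_zero,
    one_smul] at h
  exact (h θ).unique (by simpa using represents_o)

theorem exists_eq_rot_boost_smul_o {y : X} (hy : reflection y = y) :
    ∃ θ s, y = rot θ • boost s • o := by
  obtain ⟨v, h0, h2, h⟩ := exists_represents_of_reflection_eq hy
  have hsq : √(2 : ℝ) ^ 2 = 2 := Real.sq_sqrt zero_le_two
  let z : ℂ := ⟨√2 / 2 * (v 0 - v 2), v 1⟩
  have hcos : Real.cos z.arg * ‖z‖ = √2 / 2 * (v 0 - v 2) := by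
    rw [mul_comm, Complex.norm_mul_cos_arg]
  have hsin : Real.sin z.arg * ‖z‖ = v 1 := by
    rw [mul_comm, Complex.norm_mul_sin_arg]
  have hcosh : Real.cosh (Real.arsinh ‖z‖) = √2 / 2 * (v 0 + v 2) := by
    rw [Real.cosh_arsinh, Real.sqrt_eq_iff_eq_sq (by positivity) (by positivity), Complex.sq_norm,
      Complex.normSq_mk]
    linear_combination -h.1 - v 0 * v 2 * hsq
  refine ⟨z.arg, Real.arsinh ‖z‖, h.unique ?_⟩
  convert represents_rot_boost_smul_o z.arg (Real.arsinh ‖z‖) using 1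
  rw [Real.sinh_arsinh, hcosh, hcos, hsin]
  ext i
  fin_cases i <;> simp
  · linear_combination -v 0 / 2 * hsq
  · linear_combination -v 2 / 2 * hsq

theorem mem_Y_iff_reflection_eq {y : X} : y ∈ Y ↔ reflection y = y := by
  refine ⟨reflection_eq_of_mem_Y, fun hy => ?_⟩
  obtain ⟨θ, s, rfl⟩ := exists_eq_rot_boost_smul_o hy
  exact smul_mem_Y (rot_mem_H θ) ⟨boost s, boost_mem_H s, rfl⟩

/-! ### The nearest-point projection -/

theorem geodesicSymmetry_eq_reflection_iff {x y : X} (hy : y ∈ Y) :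
    geodesicSymmetry y x = reflection x ↔ dist x y = 1 / 2 * dist x (reflection x) := by
  have hdist : dist y (reflection x) = dist x y := by
    rw [← dist_reflection, reflection_reflection, reflection_eq_of_mem_Y hy, dist_comm]
  rw [geodesicSymmetry_eq_iff, hdist, and_self]

theorem exists_mem_Y_geodesicSymmetry_eq (x : X) :
    ∃ y ∈ Y, geodesicSymmetry y x = reflection x := by
  obtain ⟨m, hm⟩ := exists_geodesicSymmetry_eq x (reflection x)
  obtain ⟨h, h'⟩ := geodesicSymmetry_eq_iff.1 hm
  refine ⟨m, mem_Y_iff_reflection_eq.2 (geodesicSymmetry_left_injective x ?_), hm⟩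
  refine (geodesicSymmetry_eq_iff.2 ⟨?_, ?_⟩).trans hm.symm
  · rw [← dist_reflection, reflection_reflection, dist_comm, h']
  · rw [dist_reflection, dist_comm, h]

theorem infEDist_Y (x : X) :
    Metric.infEDist x Y = ENNReal.ofReal (1 / 2 * dist x (reflection x)) := by
  apply le_antisymm
  · obtain ⟨y, hy, h⟩ := exists_mem_Y_geodesicSymmetry_eq x
    rw [← (geodesicSymmetry_eq_reflection_iff hy).1 h, ← edist_dist]
    exact Metric.infEDist_le_edist_of_mem hy
  · refine Metric.le_infEDist.2 fun y hy => ?_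
    rw [edist_dist]
    apply ENNReal.ofReal_le_ofReal
    have hle := dist_triangle_right x (reflection x) (reflection y)
    rw [dist_reflection, reflection_eq_of_mem_Y hy] at hle
    linarith

theorem isNearestPoint_Y_iff {x y : X} :
    IsNearestPoint Y x y ↔ y ∈ Y ∧ geodesicSymmetry y x = reflection x := by
  refine and_congr_right fun hy => ?_
  rw [geodesicSymmetry_eq_reflection_iff hy, infEDist_Y, edist_dist,
    ENNReal.ofReal_eq_ofReal_iff dist_nonneg (by positivity)]

/-- The nearest-point projection onto `Y`: the midpoint of a point and its mirror image. -/
noncomputable def proj (x : X) : X := (exists_mem_Y_geodesicSymmetry_eq x).choose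

theorem isNearestPoint_iff {x y : X} : IsNearestPoint Y x y ↔ y = proj x := by
  have hx := (exists_mem_Y_geodesicSymmetry_eq x).choose_spec
  rw [isNearestPoint_Y_iff]
  exact ⟨fun hy => geodesicSymmetry_left_injective x (hy.2.trans hx.2.symm), fun h => h ▸ hx⟩

theorem proj_smul {h : G} (hh : h ∈ H) (x : X) : proj (h • x) = h • proj x := by
  obtain ⟨hY, hsymm⟩ := isNearestPoint_Y_iff.1 (isNearestPoint_iff.2 (rfl : proj x = _))
  refine (isNearestPoint_iff.1 (isNearestPoint_Y_iff.2 ⟨smul_mem_Y hh hY, ?_⟩)).symm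
  rw [geodesicSymmetry_smul_smul, hsymm, reflection_smul (H_le_SOF hh)]

theorem proj_eq_of_mul_J_mul_comm {x y : X} (hy : y ∈ Y)
    (h : y.mat * J * x.mat = x.mat * J * y.mat) : proj x = y := by
  refine (isNearestPoint_iff.1 (isNearestPoint_Y_iff.2 ⟨hy, X.ext ?_⟩)).symm
  have hyJy : y.mat * J * y.mat = J := by
    have hfix : J * y.mat⁻¹ * J = y.mat := by
      conv_rhs => rw [← reflection_eq_of_mem_Y hy, reflection, smul_mat, inv_mat, toG_J_val,
        J_transpose]
    nth_rewrite 2 [← hfix]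
    rw [Matrix.mul_assoc, ← Matrix.mul_assoc J, ← Matrix.mul_assoc J, J_mul_J, Matrix.one_mul,
      mul_nonsing_inv_cancel_left _ _ y.isUnit_det]
  have hxy : x.mat⁻¹ * y.mat * J = J * y.mat * x.mat⁻¹ := by
    rw [← mul_nonsing_inv_cancel_right _ (x.mat⁻¹ * y.mat * J) x.isUnit_det,
      Matrix.mul_assoc x.mat⁻¹, Matrix.mul_assoc x.mat⁻¹, h, Matrix.mul_assoc x.mat,
      nonsing_inv_mul_cancel_left _ _ x.isUnit_det]
  rw [geodesicSymmetry, reflection, smul_mat, smul_mat, inv_mat, X.toG_val, toG_J_val, J_transpose,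
    y.transpose_mat]
  calc y.mat * x.mat⁻¹ * y.mat = J * (J * y.mat * x.mat⁻¹) * y.mat := by
        simp only [← Matrix.mul_assoc, J_mul_J, Matrix.one_mul]
    _ = J * x.mat⁻¹ * (y.mat * J * y.mat) := by rw [← hxy]; simp only [Matrix.mul_assoc]
    _ = J * x.mat⁻¹ * J := by rw [hyJy]

/-! ### Fermi coordinates on `Y` -/

/-- The point of `Y` at signed distance `2 √3 s` from `o` on the geodesic through `o` perpendicular
to `A₀ o`. -/
noncomputable def fermi (s : ℝ) : X := rot (Real.pi / 2) • boost s • o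

theorem fermi_zero : fermi 0 = o := by
  rw [fermi, boost_zero, one_smul, rot_smul_o]

theorem fermi_mem_Y (s : ℝ) : fermi s ∈ Y :=
  smul_mem_Y (rot_mem_H _) ⟨boost s, boost_mem_H s, rfl⟩

theorem dist_fermi_o (s : ℝ) : dist (fermi s) o = 2 * √3 * |s| := by
  have h := dist_boost_smul_o s 0
  rwa [boost_zero, one_smul, sub_zero, ← dist_smul (rot (Real.pi / 2)), rot_smul_o] at h

theorem represents_fermi (s : ℝ) :
    Represents ![√2 / 2 * Real.cosh s, Real.sinh s, √2 / 2 * Real.cosh s] (fermi s) := by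
  rw [fermi]
  simpa only [Real.cos_pi_div_two, Real.sin_pi_div_two, zero_mul, one_mul, add_zero, sub_zero]
    using represents_rot_boost_smul_o (Real.pi / 2) s

theorem fermi_mat (s : ℝ) : (fermi s).mat =
    !![(Real.cosh (2 * s) + 1) / 2, √2 / 2 * Real.sinh (2 * s), (Real.cosh (2 * s) - 1) / 2;
      √2 / 2 * Real.sinh (2 * s), Real.cosh (2 * s), √2 / 2 * Real.sinh (2 * s);
      (Real.cosh (2 * s) - 1) / 2, √2 / 2 * Real.sinh (2 * s), (Real.cosh (2 * s) + 1) / 2] := by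
  have h2 : √(2 : ℝ) ^ 2 = 2 := Real.sq_sqrt zero_le_two
  have hs := Real.cosh_sq s
  rw [(represents_fermi s).2, Real.cosh_two_mul, Real.sinh_two_mul]
  ext i j
  fin_cases i <;> fin_cases j <;> simp [J] <;> grind

theorem exists_eq_boost_smul_fermi {y : X} (hy : y ∈ Y) : ∃ τ s, y = boost τ • fermi s := by
  obtain ⟨v, h0, -, hv⟩ := exists_represents_of_reflection_eq (reflection_eq_of_mem_Y hy)
  have hsq : √(2 : ℝ) ^ 2 = 2 := Real.sq_sqrt zero_le_two
  set c := Real.cosh (Real.arsinh (v 1)) with hc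
  have hcpos : 0 < c := Real.cosh_pos _
  have hc2 : c ^ 2 = 2 * v 0 * v 2 := by
    rw [hc, Real.cosh_sq, Real.sinh_arsinh]
    linear_combination -hv.1
  refine ⟨Real.log (√2 * v 0 / c), Real.arsinh (v 1), hv.unique ?_⟩
  convert (represents_fermi _).boost_smul _ using 1
  rw [Real.exp_neg, Real.exp_log (by positivity), Real.sinh_arsinh, ← hc]
  ext i
  fin_cases i <;> simp <;> field_simp
  · linear_combination -hsq
  · linear_combination -hc2

/-! ### The projection of a floating plane -/

theorem a_val (t : ℝ) : (a t).1 = diagonal ![Real.exp t, Real.exp (-2 * t), Real.exp t] := rfl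

theorem a_mul_boost (t τ : ℝ) : a t * boost τ = boost τ * a t :=
  Subtype.ext (commute_diagonal _ _)

theorem proj_a_smul_fermi {t s s' : ℝ}
    (h : Real.tanh (2 * s') = Real.tanh (2 * s) / Real.cosh (3 * t)) :
    proj (a t • fermi s) = fermi s' := by
  have hexp : Real.exp t * Real.exp (-2 * t) = Real.exp (-t) := by
    rw [← Real.exp_add]
    ring_nf
  have hcosh : 2 * Real.exp (-t) * Real.cosh (3 * t) = Real.exp t ^ 2 + Real.exp (-2 * t) ^ 2 := by
    rw [Real.cosh_eq, ← Real.exp_nat_mul, ← Real.exp_nat_mul]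
    ring_nf
    rw [← Real.exp_add, ← Real.exp_add]
    ring_nf
  have hkey : 2 * Real.cosh (2 * s') * (Real.exp t * Real.exp (-2 * t)) * Real.sinh (2 * s) =
      Real.sinh (2 * s') * Real.cosh (2 * s) * (Real.exp t ^ 2 + Real.exp (-2 * t) ^ 2) := by
    rw [Real.tanh_eq_sinh_div_cosh, Real.tanh_eq_sinh_div_cosh, div_div,
      div_eq_div_iff (Real.cosh_pos _).ne' (by positivity)] at h
    rw [hexp, ← hcosh]
    linear_combination -2 * Real.exp (-t) * h
  refine proj_eq_of_mul_J_mul_comm (fermi_mem_Y s') ?_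
  rw [smul_mat, a_val, diagonal_transpose, fermi_mat, fermi_mat]
  ext i j
  fin_cases i <;> fin_cases j <;> simp [-neg_mul, J, mul_apply, Fin.sum_univ_three]
  · ring
  · linear_combination √2 / 2 * hkey
  · ring
  · linear_combination -√2 / 2 * hkey
  · ring
  · linear_combination -√2 / 2 * hkey
  · ring
  · linear_combination √2 / 2 * hkey
  · ring

/-! ### Complete geodesics in `Y` -/

theorem geodesicSymmetry_isometry {c : ℝ → X} (hc : Isometry c) (s t : ℝ) :
    geodesicSymmetry (c t) (c s) = c (2 * t - s) := by
  rw [geodesicSymmetry_eq_iff]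
  simp only [hc.dist_eq, Real.dist_eq]
  have h : |s - (2 * t - s)| = 2 * |s - t| := by
    rw [show s - (2 * t - s) = 2 * (s - t) by ring, abs_mul, abs_two]
  rw [h, show t - (2 * t - s) = s - t by ring]
  constructor <;> ring

theorem eq_of_isometry_of_eq_zero_of_eq_one {c e : ℝ → X} (hc : Isometry c) (he : Isometry e)
    (h0 : c 0 = e 0) (h1 : c 1 = e 1) : c = e := by
  have hsymm {s t : ℝ} (hs : c s = e s) (ht : c t = e t) : c (2 * t - s) = e (2 * t - s) := by
    rw [← geodesicSymmetry_isometry hc, hs, ht, geodesicSymmetry_isometry he]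
  have hnat (n : ℕ) : c n = e n := by
    induction n using Nat.twoStepInduction with
    | zero => simpa using h0
    | one => simpa using h1
    | more n ih ih' =>
      convert hsymm ih ih' using 2 <;> push_cast <;> ring
  have hneg (n : ℕ) : c (-n) = e (-n) := by
    simpa using hsymm (hnat n) h0
  funext t
  obtain ⟨n, hn⟩ := exists_nat_gt |t|
  obtain ⟨hnt, htn⟩ := abs_lt.1 hn
  have hn0 : (0 : ℝ) < n := (abs_nonneg t).trans_lt hn
  have hdist {f : ℝ → X} (hf : Isometry f) :
      dist (f (-n)) (f t) = (t + n) / (2 * n) * dist (f (-n)) (f n) ∧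
        dist (f t) (f n) = (1 - (t + n) / (2 * n)) * dist (f (-n)) (f n) := by
    simp only [hf.dist_eq, Real.dist_eq]
    rw [abs_of_nonpos (by linarith), abs_of_nonpos (by linarith), abs_of_nonpos (by linarith)]
    constructor <;> field_simp <;> ring
  have hτ : (t + n) / (2 * n) ∈ Set.Icc (0 : ℝ) 1 :=
    ⟨div_nonneg (by linarith) (by positivity), (div_le_one (by positivity)).2 (by linarith)⟩
  obtain ⟨hl, hr⟩ := hdist hc
  obtain ⟨hl', hr'⟩ := hdist he
  rw [← hneg, ← hnat] at hl' hr'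
  exact eq_of_dist_eq_mul hτ hl hr hl' hr'

theorem exists_eq_smul_A₀ {L : Set X} (hL : IsCompleteGeodesic L) (hLY : L ⊆ Y) :
    ∃ h ∈ H, L = {z | ∃ g ∈ A₀, z = h • g • o} := by
  obtain ⟨c, hc, rfl⟩ := hL
  obtain ⟨h₀, hh₀, hc0⟩ := hLY ⟨0, rfl⟩
  obtain ⟨θ, s, hc1⟩ := exists_eq_rot_boost_smul_o
    (reflection_eq_of_mem_Y (smul_mem_Y (inv_mem hh₀) (hLY ⟨1, rfl⟩)))
  rw [inv_smul_eq_iff, smul_smul] at hc1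
  set h := h₀ * rot θ with hh
  replace hc0 : c 0 = h • boost 0 • o := by
    rw [hc0, hh, boost_zero, one_smul, mul_smul, rot_smul_o]
  have hunit : 2 * √3 * |s| = 1 := by
    rw [← sub_zero s, ← dist_boost_smul_o, ← dist_smul h, ← hc1, ← hc0, hc.dist_eq, dist_zero_right,
      norm_one]
  have hs : s ≠ 0 := by
    rintro rfl
    norm_num at hunit
  have hc_eq : c = fun t => h • boost (s * t) • o := by
    refine eq_of_isometry_of_eq_zero_of_eq_one hc (Isometry.of_dist_eq fun t t' => ?_) ?_ ?_
    · rw [dist_smul, dist_boost_smul_o, ← mul_sub, abs_mul, ← mul_assoc, hunit, one_mul,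
        Real.dist_eq]
    · rwa [mul_zero]
    · rwa [mul_one]
  refine ⟨h, mul_mem hh₀ (rot_mem_H θ), Set.ext fun z => ⟨?_, ?_⟩⟩
  · rintro ⟨t, rfl⟩
    exact ⟨boost (s * t), mem_A₀_iff.2 ⟨_, rfl⟩, by rw [hc_eq]⟩
  · rintro ⟨g, hg, rfl⟩
    obtain ⟨u, rfl⟩ := mem_A₀_iff.1 hg
    exact ⟨u / s, by simp only [hc_eq, mul_div_cancel₀ _ hs]⟩

/-! ### Floating planes far away from `Y` -/

theorem proj_smul_a_smul_boost_smul {h : G} (hh : h ∈ H) (t τ : ℝ) (x : X) :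
    proj (h • a t • boost τ • x) = h • boost τ • proj (a t • x) := by
  rw [proj_smul hh, smul_smul (a t), a_mul_boost, mul_smul, proj_smul (boost_mem_H τ)]

theorem proj_a_smul_o (t : ℝ) : proj (a t • o) = o := by
  rw [← fermi_zero]
  apply proj_a_smul_fermi
  simp only [mul_zero, Real.tanh_zero, zero_div]

theorem abs_artanh_le_artanh {u r : ℝ} (hr : r < 1) (hu : |u| ≤ r) :
    |Real.artanh u| ≤ Real.artanh r := by
  obtain ⟨hru, hur⟩ := abs_le.1 hu
  have hneg : Real.artanh (-r) = -Real.artanh r := by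
    rw [← Real.artanh_tanh (-Real.artanh r), Real.tanh_neg, Real.tanh_artanh ⟨by linarith, hr⟩]
  rw [abs_le, ← hneg]
  exact ⟨Real.artanh_le_artanh (by linarith) (by linarith) hru,
    Real.artanh_le_artanh (by linarith) hr hur⟩

theorem dist_proj_a_smul_fermi_le {t : ℝ} (ht : t ≠ 0) (s : ℝ) :
    dist (proj (a t • fermi s)) o ≤ √3 * Real.artanh (1 / Real.cosh (3 * t)) := by
  have hlt : 1 / Real.cosh (3 * t) < 1 := by
    rw [div_lt_one (Real.cosh_pos _), Real.one_lt_cosh]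
    positivity
  set u := Real.tanh (2 * s) / Real.cosh (3 * t)
  have hu : |u| ≤ 1 / Real.cosh (3 * t) := by
    rw [abs_div, abs_of_pos (Real.cosh_pos _)]
    gcongr
    exact (Real.abs_tanh_lt_one _).le
  have htanh : Real.tanh (2 * (Real.artanh u / 2)) = u := by
    rw [mul_div_cancel₀ _ two_ne_zero, Real.tanh_artanh (abs_lt.1 (hu.trans_lt hlt))]
  calc dist (proj (a t • fermi s)) o = √3 * |Real.artanh u| := by
        rw [proj_a_smul_fermi htanh, dist_fermi_o, abs_div, abs_two]
        ring
    _ ≤ √3 * Real.artanh (1 / Real.cosh (3 * t)) := by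
        gcongr
        exact abs_artanh_le_artanh hlt hu

theorem hausdorffEDist_proj_floatingPlane_le {L : Set X} (hL : IsCompleteGeodesic L) (hLY : L ⊆ Y)
    {t : ℝ} (ht : t ≠ 0) : Metric.hausdorffEDist (proj '' floatingPlane L t) L ≤
      ENNReal.ofReal (√3 * Real.artanh (1 / Real.cosh (3 * t))) := by
  refine Metric.hausdorffEDist_le_of_mem_edist ?_ ?_
  · rintro _ ⟨_, ⟨h, hh, rfl, y, hy, rfl⟩, rfl⟩
    obtain ⟨τ, s, rfl⟩ := exists_eq_boost_smul_fermi hy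
    refine ⟨h • boost τ • o, ⟨boost τ, mem_A₀_iff.2 ⟨τ, rfl⟩, rfl⟩, ?_⟩
    rw [proj_smul_a_smul_boost_smul hh, edist_dist, dist_smul, dist_smul]
    exact ENNReal.ofReal_le_ofReal (dist_proj_a_smul_fermi_le ht s)
  · obtain ⟨h, hh, hLh⟩ := exists_eq_smul_A₀ hL hLY
    intro z hz
    obtain ⟨g, hg, rfl⟩ : ∃ g ∈ A₀, z = h • g • o := by rwa [hLh] at hz
    obtain ⟨τ, rfl⟩ := mem_A₀_iff.1 hg
    refine ⟨_, ⟨_, ⟨h, hh, hLh, boost τ • o, ⟨_, boost_mem_H τ, rfl⟩, rfl⟩, rfl⟩, ?_⟩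
    rw [proj_smul_a_smul_boost_smul hh, proj_a_smul_o, edist_self]
    exact zero_le

theorem tendsto_artanh_one_div_cosh :
    Tendsto (fun t : ℝ => ENNReal.ofReal (√3 * Real.artanh (1 / Real.cosh (3 * t))))
      (comap (fun t : ℝ => |t|) atTop) (𝓝 0) := by
  have hcosh : Tendsto Real.cosh atTop atTop :=
    tendsto_atTop_mono' _ ((eventually_ge_atTop 0).mono fun x hx =>
      (Real.self_le_sinh_iff.2 hx).trans (Real.sinh_lt_cosh x).le) tendsto_id
  have h3 : Tendsto (fun t : ℝ => 3 * |t|) (comap (fun t : ℝ => |t|) atTop) atTop :=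
    tendsto_comap.const_mul_atTop three_pos
  have habs (t : ℝ) : Real.cosh (3 * |t|) = Real.cosh (3 * t) := by
    rw [← Real.cosh_abs (3 * t), abs_mul, Nat.abs_ofNat]
  have hartanh : ContinuousAt Real.artanh 0 := by
    unfold Real.artanh
    fun_prop (disch := norm_num)
  have hlim : Tendsto (fun t : ℝ => 1 / Real.cosh (3 * t))
      (comap (fun t : ℝ => |t|) atTop) (𝓝 0) := by
    simpa only [habs, Function.comp_def] using tendsto_const_nhds.div_atTop (hcosh.comp h3)
  have h := (hartanh.tendsto.comp hlim).const_mul √3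
  rw [Real.artanh_zero, mul_zero] at h
  simpa only [ENNReal.ofReal_zero, Function.comp_def] using ENNReal.tendsto_ofReal h

end FloatingPlane

theorem mainTheorem4 :
    ∃ π : FloatingPlane.X → FloatingPlane.X,
      (∀ x y, FloatingPlane.IsNearestPoint FloatingPlane.Y x y ↔ y = π x) ∧
      ∀ L : Set FloatingPlane.X, FloatingPlane.IsCompleteGeodesic L → L ⊆ FloatingPlane.Y →
        Tendsto (fun t : ℝ => Metric.hausdorffEDist (π '' FloatingPlane.floatingPlane L t) L)
          (comap (fun t : ℝ => |t|) atTop) (𝓝 0) := by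
  refine ⟨FloatingPlane.proj, fun x y => FloatingPlane.isNearestPoint_iff, fun L hL hLY => ?_⟩
  have hne : ∀ᶠ t in comap (fun t : ℝ => |t|) atTop, t ≠ 0 := by
    filter_upwards [tendsto_comap.eventually_gt_atTop 0] with t ht
    exact abs_pos.1 ht
  refine tendsto_of_tendsto_of_tendsto_of_le_of_le' tendsto_const_nhds
    FloatingPlane.tendsto_artanh_one_div_cosh (Eventually.of_forall fun _ => zero_le) ?_
  filter_upwards [hne] with t ht
  exact FloatingPlane.hausdorffEDist_proj_floatingPlane_le hL hLY ht
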